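/- \textbf{Trace formula.} Let $d\ge 3$, let $U\subset\mathbb R^2$ be open with coordinates $(x,y)$, and let $f_1,\dots,f_d$ be first integrals of a planar $d$-web $W(f_1,\dots,f_d)$ on $U$, i.e. real functions, $C^\infty$ on $U$, with $df_i\wedge df_j\neq 0$ at every point of $U$ for $i\ne j$. For $a,b\ge 0$ write $\partial_x^a\partial_y^b(h\circ f)=\sum_k C_{a,b,k}(f)\,h^{(k)}(f)$, where the $C_{a,b,k}(f)$ are the universal polynomials in the partial derivatives of $f$ given by the chain rule. For $r\ge 2$ let $G_r^{m}$ ($2\le m\le r-1$) be the $r\times d$ matrix with $(i,j)$ entry $C_{r-i,\,i-1,\,r-m}(f_j)$, and let $P_r$ be the $r\times d$ matrix with entries $C_{r-i,i-1,r-1}(f_j)=(f_{j,x})^{r-i}(f_{j,y})^{i-1}$; thus the equations of order $r-1$ obtained by differentiating $\sum_i h_i(f_i)=0$ are $G_r^{r-1}\omega^1+\dots+G_r^2\omega^{r-2}+P_r\omega^{r-1}=0$, where $\omega^k=(h_i^{(k)}(f_i))_{i=1,\dots,d}$. Let $MM$ be the matrix of the system of all these equations for $r=2,\dots,d-1$,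 in the unknown $(\omega^1,\dots,\omega^{d-2})\in\mathbb R^{d(d-2)}$. With $A_m=-P_d^{-1}G_d^m$, let $\Delta$ be the $d(d-2)\times d(d-2)$ matrix $$\Delta(\omega^1,\dots,\omega^{d-2})=\Bigl(\omega^2,\dots,\omega^{d-2},\ \sum_{k=1}^{d-2}A_{d-k}\,\omega^k\Bigr),$$ and for $v\in\mathbb R^2$ let $\Delta_v=DD_v\,\Delta$, where $DD_v$ is block diagonal with all its $d-2$ blocks equal to $\mathrm{diag}(df_1(v),\dots,df_d(v))$. Let $\nabla^0$ be the connection $\nabla^0_v s=\partial_v s-\Delta_v s$ on the trivial bundle of rank $d(d-2)$ over $U$. Then $\ker MM$ has constant rank $(d-1)(d-2)/2$ on $U$, and $\nabla^0$ maps smooth sections of $\ker MM$ (over open subsets of $U$) to sections of $\ker MM$; let $\nabla$ be the induced connection on $\ker MM$. Its curvature, given by $R(u,v)s=\nabla_u\nabla_v s-\nabla_v\nabla_u s$ for constant vector fields $u,v$ and smooth sections $s$, is a well-defined $\mathrm{End}(\ker MM)$-valued $2$-form on $U$. Its trace is the sum of the Blaschke curvatures of the sub-3-webs: as scalar $2$-forms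 on $U$, $$\operatorname{tr}R=\sum_{1\le i<j<k\le d}B(f_i,f_j,f_k).$$ Here the Blaschke curvature $B(f,g,h)$ of a 3-web $W(f,g,h)$ is the $2$-form $d\gamma$, where, for $1$-forms $\omega_1,\omega_2,\omega_3$ that are nowhere-vanishing multiples of $df,dg,dh$ with $\omega_1+\omega_2+\omega_3=0$, $\gamma$ is the unique $1$-form with $d\omega_i=\gamma\wedge\omega_i$ for $i=1,2,3$ (and $d\gamma$ does not depend on the choice of the $\omega_i$). -/

import Mathlib

open scoped ContDiff

noncomputable section

namespace PlanarWeb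

/-! ### Planar webs given by first integrals -/

/-- The derivative of `g` in the constant direction `v`. -/
def dirDeriv (v : ℝ × ℝ) (g : ℝ × ℝ → ℝ) (p : ℝ × ℝ) : ℝ :=
  fderiv ℝ g p v

/-- The constant vector field `∂/∂x`. -/
def dX : ℝ × ℝ := (1, 0)

/-- The constant vector field `∂/∂y`. -/
def dY : ℝ × ℝ := (0, 1)

/-- The coefficient of `α ∧ β` with respect to `dx ∧ dy`, for 1-forms `α`, `β` on the plane. -/
def wedge (α β : ℝ × ℝ → (ℝ × ℝ →L[ℝ] ℝ)) (p : ℝ × ℝ) : ℝ :=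
  α p dX * β p dY - α p dY * β p dX

/-- `f_1, …, f_d` are first integrals of a `d`-web on `U`: they are smooth on `U`, and their
level curves are pairwise transverse at each point of `U`. (For `d ≥ 2` transversality forces
each `df_i` to be non-zero, so that the level curves do form foliations.) -/
structure IsWeb {d : ℕ} (U : Set (ℝ × ℝ)) (f : Fin d → ℝ × ℝ → ℝ) : Prop where
  smooth : ∀ i, ContDiffOn ℝ ∞ (f i) U
  transverse : ∀ p ∈ U, ∀ i j, i ≠ j → wedge (fderiv ℝ (f i)) (fderiv ℝ (f j)) p ≠ 0

/-! ### The equations obtained by differentiating an abelian relation -/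

/-- If a quantity has the form `∑ k, c k * h^{(k)}(f)`, then its derivative in the direction `v`
is `∑ k, (chainStep v f c) k * h^{(k)}(f)`. -/
def chainStep (v : ℝ × ℝ) (f : ℝ × ℝ → ℝ) (c : ℕ → ℝ × ℝ → ℝ) : ℕ → ℝ × ℝ → ℝ
  | 0 => fun p => dirDeriv v (c 0) p
  | k + 1 => fun p => dirDeriv v f p * c k p + dirDeriv v (c (k + 1)) p

/-- The universal coefficients in
`∂_x^a ∂_y^b (h ∘ f) = ∑ k, chainCoeff f a b k * h^{(k)}(f)`. -/
def chainCoeff (f : ℝ × ℝ → ℝ) (a b : ℕ) : ℕ → ℝ × ℝ → ℝ :=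
  (chainStep dX f)^[a] ((chainStep dY f)^[b] (fun k _ => if k = 0 then 1 else 0))

/-- The `r × d` block multiplying `(ω^k_1, …, ω^k_d)`, where `ω^k_i = h_i^{(k)}(f_i)`, in the `r`
equations of order `r - 1` obtained from `∑ i, h_i(f_i) = 0` by applying
`∂_x^{r-1}, ∂_x^{r-2} ∂_y, …, ∂_y^{r-1}`. In the usual notation it is `G_r^{r-k}` if `k < r - 1`,
it is `P_r` if `k = r - 1`, and it is zero if `k > r - 1`. -/
def block {d : ℕ} (f : Fin d → ℝ × ℝ → ℝ) (r k : ℕ) (p : ℝ × ℝ) :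
    Matrix (Fin r) (Fin d) ℝ :=
  Matrix.of fun i j => chainCoeff (f j) (r - 1 - i) i k p

/-- The matrix `P_r`, whose `j`-th column is `(f_{jx}^{r-1}, f_{jx}^{r-2} f_{jy}, …, f_{jy}^{r-1})`. -/
def matP {d : ℕ} (f : Fin d → ℝ × ℝ → ℝ) (r : ℕ) (p : ℝ × ℝ) : Matrix (Fin r) (Fin d) ℝ :=
  block f r (r - 1) p

/-- The matrix `G_r^m`. -/
def matG {d : ℕ} (f : Fin d → ℝ × ℝ → ℝ) (r m : ℕ) (p : ℝ × ℝ) : Matrix (Fin r) (Fin d) ℝ :=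
  block f r (r - m) p

/-- Index set of the vectors `(ω^1_1, …, ω^1_d; …; ω^{d-2}_1, …, ω^{d-2}_d)`: the pair `(k, i)`
stands for `ω^{k+1}_{i+1}`. -/
abbrev Idx (d : ℕ) : Type := Fin (d - 2) × Fin d

/-- The matrix `MM` of all the equations of orders `1, …, d - 2`: its block row with index `r` is
the system of `r + 2` equations of order `r + 1`. It is block lower triangular, with diagonal blocks
`P_2, …, P_{d-1}`. -/
def matMM {d : ℕ} (f : Fin d → ℝ × ℝ → ℝ) (p : ℝ × ℝ) :
    Matrix (Σ r : Fin (d - 2), Fin ((r : ℕ) + 2)) (Idx d) ℝ :=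
  Matrix.of fun ri kj => block f ((ri.1 : ℕ) + 2) ((kj.1 : ℕ) + 1) p ri.2 kj.2

/-- The fibre at `p` of the vector bundle of the web, the kernel of `MM`. -/
def fiber {d : ℕ} (f : Fin d → ℝ × ℝ → ℝ) (p : ℝ × ℝ) : Submodule ℝ (Idx d → ℝ) :=
  LinearMap.ker (matMM f p).mulVecLin

/-! ### The connection -/

/-- The matrix `A_m = - P_d⁻¹ G_d^m`. -/
def matA {d : ℕ} (f : Fin d → ℝ × ℝ → ℝ) (m : ℕ) (p : ℝ × ℝ) : Matrix (Fin d) (Fin d) ℝ :=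
  -((matP f d p)⁻¹ * matG f d m p)

/-- The matrix `Δ`: the block row `k` (counted from `0`) has the identity in block column `k + 1`
if `k` is not the last one, and the last block row is `A_{d-1}, A_{d-2}, …, A_2`. -/
def matDelta {d : ℕ} (f : Fin d → ℝ × ℝ → ℝ) (p : ℝ × ℝ) : Matrix (Idx d) (Idx d) ℝ :=
  Matrix.of fun ki lj =>
    if (ki.1 : ℕ) + 1 < d - 2 then
      if (lj.1 : ℕ) = (ki.1 : ℕ) + 1 ∧ lj.2 = ki.2 then 1 else 0
    else matA f (d - 1 - lj.1) p ki.2 lj.2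

/-- The matrix `DD_v Δ`, where `DD_v` is block diagonal with all diagonal blocks equal to
`diag (df_1(v), …, df_d(v))`. For `v = ∂/∂x` and `v = ∂/∂y` these are `Δ_x` and `Δ_y`. -/
def matDeltaDir {d : ℕ} (f : Fin d → ℝ × ℝ → ℝ) (v : ℝ × ℝ) (p : ℝ × ℝ) :
    Matrix (Idx d) (Idx d) ℝ :=
  Matrix.diagonal (fun ki : Idx d => dirDeriv v (f ki.2) p) * matDelta f p

/-- The covariant derivative `∇_v s` of `s` along the constant vector field `v`, for the connection
`∇⁰` on the trivial bundle; the connection `∇` of the web is its restriction to sections of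
the kernel of `MM`. -/
def nabla {d : ℕ} (f : Fin d → ℝ × ℝ → ℝ) (v : ℝ × ℝ) (s : ℝ × ℝ → Idx d → ℝ) :
    ℝ × ℝ → Idx d → ℝ :=
  fun p => fderiv ℝ s p v - (matDeltaDir f v p).mulVec (s p)

/-- `s` is a smooth section over `V` of the bundle `ker MM`. -/
structure IsSection {d : ℕ} (f : Fin d → ℝ × ℝ → ℝ) (V : Set (ℝ × ℝ))
    (s : ℝ × ℝ → Idx d → ℝ) : Prop where
  smooth : ContDiffOn ℝ ∞ s V
  mem : ∀ p ∈ V, s p ∈ fiber f p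

/-- `K` is the value `R_p(u, v)` of the curvature of `∇` at `p`: it is the endomorphism of the fibre
with `R(u, v) s = ∇_u ∇_v s - ∇_v ∇_u s` at `p` for all smooth sections `s` of `ker MM` near `p`.
(The vector fields `u` and `v` are constant, so their bracket vanishes.) -/
def IsCurvatureAt {d : ℕ} (f : Fin d → ℝ × ℝ → ℝ) (p u v : ℝ × ℝ)
    (K : Module.End ℝ (fiber f p)) : Prop :=
  ∀ (V : Set (ℝ × ℝ)) (_ : IsOpen V) (hp : p ∈ V) (s : ℝ × ℝ → Idx d → ℝ)
    (hs : IsSection f V s),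
    (K ⟨s p, hs.mem p hp⟩ : Idx d → ℝ) =
      nabla f u (nabla f v s) p - nabla f v (nabla f u s) p

/-! ### The Blaschke curvature of a 3-web -/

/-- The exterior derivative of a 1-form. -/
def extD (α : ℝ × ℝ → (ℝ × ℝ →L[ℝ] ℝ)) : ℝ × ℝ → (ℝ × ℝ) [⋀^Fin 2]→L[ℝ] ℝ :=
  extDeriv fun p => ContinuousAlternatingMap.ofSubsingleton ℝ (ℝ × ℝ) ℝ (0 : Fin 1) (α p)

/-- For first integrals `f`, `g`, `h` of a 3-web, the 1-form `(dg ∧ dh) df`. The forms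
`ω₁ = normForm f g h`, `ω₂ = normForm g h f`, `ω₃ = normForm h f g` define the three foliations and
satisfy `ω₁ + ω₂ + ω₃ = 0`. -/
def normForm (f g h : ℝ × ℝ → ℝ) (p : ℝ × ℝ) : ℝ × ℝ →L[ℝ] ℝ :=
  wedge (fderiv ℝ g) (fderiv ℝ h) p • fderiv ℝ f p

/-- The Blaschke connection form of the 3-web: with `dω_i = h_i ω₁ ∧ ω₂` it is
`γ = h₂ ω₁ - h₁ ω₂`, the unique 1-form with `dω_i = γ ∧ ω_i` for `i = 1, 2, 3`. -/
def blaschkeForm (f g h : ℝ × ℝ → ℝ) (p : ℝ × ℝ) : ℝ × ℝ →L[ℝ] ℝ :=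
  let ω₁ := normForm f g h
  let ω₂ := normForm g h f
  let h₁ := extD ω₁ p ![dX, dY] / wedge ω₁ ω₂ p
  let h₂ := extD ω₂ p ![dX, dY] / wedge ω₁ ω₂ p
  h₂ • ω₁ p - h₁ • ω₂ p

/-- The Blaschke curvature of the 3-web `W(f, g, h)`: the 2-form `dγ`. It does not change if the
forms `ω_i` are multiplied by a common non-vanishing function. -/
def blaschkeCurvature (f g h : ℝ × ℝ → ℝ) : ℝ × ℝ → (ℝ × ℝ) [⋀^Fin 2]→L[ℝ] ℝ :=
  extD (blaschkeForm f g h)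

end PlanarWeb

end

noncomputable section

namespace PlanarWeb

/-! ### Smoothness and the chain coefficients -/

/-! Complete `w = (ω^1, …, ω^{d-2})` by the `ω^{d-1}` that solves the equations of order `d - 1`,
and let `E_{a,b}(w)` be the equation obtained by `∂_x^a ∂_y^b` (`jetEq`). Then `ker MM` is cut out
by the `E_{a,b}` with `1 ≤ a + b ≤ d - 2`, and its rank is a count of rows, `MM` being block
triangular with Vandermonde-type diagonal blocks. Everything about `∇⁰` follows from one identity
(`IsWeb.jetEq_nabla`): `E_{a,b}(∇_v s) = ∂_v E_{a,b}(s) - v₁ E_{a+1,b}(s) - v₂ E_{a,b+1}(s)`. It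
shows that `∇⁰` preserves sections of `ker MM`. Applied twice, it shows that the curvature matrix of
`∇⁰` sends every vector, not only those of the fibre, into `ker MM`. Hence the trace of `R` equals
the trace of the full matrix, where the commutator term disappears: `tr R(u,v) = ∂_v tr Δ_u - ∂_u tr
Δ_v`.

In `Δ` only the last diagonal block has diagonal entries, so `tr Δ_v = ∑ i, df_i(v) (A_2)_{ii}`. To
find `(A_2)_{ii}`, let `X_j` be the vector at `p` tangent to the level curve of `f_j` with
`df_i(X_j) = 1`, frozen to a constant field. The operator `∏_{j ≠ i} X_j` has a symbol vanishing on
each `df_j`, `j ≠ i`, and equal to `1` on `df_i`; its coefficients therefore form row `i` of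
`P_d⁻¹`, and `-(A_2)_{ii}` is its next-to-top chain rule coefficient on `f_i`, namely the sum of
`Hess f_i (X_j, X_k)` over pairs `{j, k}` (`IsWeb.two_mul_matA_diag`). The Blaschke form of a 3-web
is a sum of three such Hessian terms, one for each function (`blaschkeForm_apply`), so `tr Δ_v = -∑
γ_{ijk}(v)` over all triples. Taking `d` gives the formula. -/

theorem dirDeriv_contDiffOn {U : Set (ℝ × ℝ)} (hU : IsOpen U) {g : ℝ × ℝ → ℝ}
    (hg : ContDiffOn ℝ ∞ g U) (v : ℝ × ℝ) : ContDiffOn ℝ ∞ (dirDeriv v g) U :=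
  (hg.fderiv_of_isOpen hU (m := ∞) (by simp)).clm_apply contDiffOn_const

theorem ContDiffOn.differentiableAt_of_isOpen {F : Type*} [NormedAddCommGroup F] [NormedSpace ℝ F]
    {U : Set (ℝ × ℝ)} (hU : IsOpen U) {g : ℝ × ℝ → F}
    (hg : ContDiffOn ℝ ∞ g U) {p : ℝ × ℝ} (hp : p ∈ U) : DifferentiableAt ℝ g p :=
  (hg.contDiffAt (hU.mem_nhds hp)).differentiableAt (by simp)

theorem dirDeriv_congr {U : Set (ℝ × ℝ)} (hU : IsOpen U) {g h : ℝ × ℝ → ℝ} (H : U.EqOn g h)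
    (v : ℝ × ℝ) : U.EqOn (dirDeriv v g) (dirDeriv v h) := fun p hp => by
  simp only [dirDeriv]
  rw [(H.eventuallyEq_of_mem (hU.mem_nhds hp)).fderiv_eq]

theorem dirDeriv_const (v : ℝ × ℝ) (c : ℝ) (p : ℝ × ℝ) : dirDeriv v (fun _ => c) p = 0 := by
  simp [dirDeriv]

theorem dirDeriv_add {g h : ℝ × ℝ → ℝ} {p : ℝ × ℝ} (hg : DifferentiableAt ℝ g p)
    (hh : DifferentiableAt ℝ h p) (v : ℝ × ℝ) :
    dirDeriv v (fun q => g q + h q) p = dirDeriv v g p + dirDeriv v h p := by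
  simp [dirDeriv, fderiv_fun_add hg hh]

theorem dirDeriv_sub {g h : ℝ × ℝ → ℝ} {p : ℝ × ℝ} (hg : DifferentiableAt ℝ g p)
    (hh : DifferentiableAt ℝ h p) (v : ℝ × ℝ) :
    dirDeriv v (fun q => g q - h q) p = dirDeriv v g p - dirDeriv v h p := by
  simp [dirDeriv, fderiv_fun_sub hg hh]

theorem dirDeriv_mul {g h : ℝ × ℝ → ℝ} {p : ℝ × ℝ} (hg : DifferentiableAt ℝ g p)
    (hh : DifferentiableAt ℝ h p) (v : ℝ × ℝ) :
    dirDeriv v (fun q => g q * h q) p = dirDeriv v g p * h p + g p * dirDeriv v h p := by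
  simp [dirDeriv, fderiv_fun_mul hg hh]; ring

theorem dirDeriv_sum {ι : Type*} {S : Finset ι} {g : ι → ℝ × ℝ → ℝ} {p : ℝ × ℝ}
    (hg : ∀ i ∈ S, DifferentiableAt ℝ (g i) p) (v : ℝ × ℝ) :
    dirDeriv v (fun q => ∑ i ∈ S, g i q) p = ∑ i ∈ S, dirDeriv v (g i) p := by
  simp only [dirDeriv]
  rw [fderiv_fun_sum hg]
  simp

theorem dirDeriv_eq (v : ℝ × ℝ) (g : ℝ × ℝ → ℝ) (p : ℝ × ℝ) :
    dirDeriv v g p = v.1 * dirDeriv dX g p + v.2 * dirDeriv dY g p := by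
  have : v = v.1 • dX + v.2 • dY := by ext <;> simp [dX, dY]
  conv_lhs => rw [this]
  simp [dirDeriv]

theorem dirDeriv_comm {U : Set (ℝ × ℝ)} (hU : IsOpen U) {g : ℝ × ℝ → ℝ}
    (hg : ContDiffOn ℝ ∞ g U) (u v : ℝ × ℝ) {p : ℝ × ℝ} (hp : p ∈ U) :
    dirDeriv u (dirDeriv v g) p = dirDeriv v (dirDeriv u g) p := by
  have hd : DifferentiableAt ℝ (fderiv ℝ g) p :=
    ContDiffOn.differentiableAt_of_isOpen hU (hg.fderiv_of_isOpen hU (m := ∞) (by simp)) hp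
  have key (a b : ℝ × ℝ) : dirDeriv a (dirDeriv b g) p = fderiv ℝ (fderiv ℝ g) p a b := by
    change fderiv ℝ (fun q => fderiv ℝ g q b) p a = _
    rw [fderiv_clm_apply hd (differentiableAt_const b)]
    simp
  have hs : IsSymmSndFDerivAt ℝ g p :=
    (hg.contDiffAt (hU.mem_nhds hp)).isSymmSndFDerivAt (by
      rw [minSmoothness_of_isRCLikeNormedField]; exact WithTop.coe_le_coe.mpr le_top)
  rw [key, key, hs.eq]

theorem chainStep_contDiffOn {U : Set (ℝ × ℝ)} (hU : IsOpen U) {f : ℝ × ℝ → ℝ}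
    (hf : ContDiffOn ℝ ∞ f U) (v : ℝ × ℝ) {c : ℕ → ℝ × ℝ → ℝ}
    (hc : ∀ k, ContDiffOn ℝ ∞ (c k) U) : ∀ k, ContDiffOn ℝ ∞ (chainStep v f c k) U
  | 0 => dirDeriv_contDiffOn hU (hc 0) v
  | k + 1 => ((dirDeriv_contDiffOn hU hf v).mul (hc k)).add (dirDeriv_contDiffOn hU (hc (k + 1)) v)

theorem chainStep_congr {U : Set (ℝ × ℝ)} (hU : IsOpen U) (f : ℝ × ℝ → ℝ) (v : ℝ × ℝ)
    {c c' : ℕ → ℝ × ℝ → ℝ} (hc : ∀ k, U.EqOn (c k) (c' k)) :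
    ∀ k, U.EqOn (chainStep v f c k) (chainStep v f c' k)
  | 0 => dirDeriv_congr hU (hc 0) v
  | k + 1 => fun p hp => by
    simp only [chainStep, hc k hp, dirDeriv_congr hU (hc (k + 1)) v hp]

/-- `chainStep v` is `∂_v` acting on formal sums `∑ c_k h^{(k)}(f)`, so this is the symmetry of the
second derivatives of `f` and of the `c_k`. It frees `chainCoeff` from the order in which its
derivatives are applied. -/
theorem chainStep_comm {U : Set (ℝ × ℝ)} (hU : IsOpen U) {f : ℝ × ℝ → ℝ}
    (hf : ContDiffOn ℝ ∞ f U) (u v : ℝ × ℝ) {c : ℕ → ℝ × ℝ → ℝ}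
    (hc : ∀ k, ContDiffOn ℝ ∞ (c k) U) (k : ℕ) :
    U.EqOn (chainStep u f (chainStep v f c) k) (chainStep v f (chainStep u f c) k) := by
  intro p hp
  have hfv (v) := ContDiffOn.differentiableAt_of_isOpen hU (dirDeriv_contDiffOn hU hf v) hp
  have hc1 (k) := ContDiffOn.differentiableAt_of_isOpen hU (hc k) hp
  have hcv (k v) := ContDiffOn.differentiableAt_of_isOpen hU (dirDeriv_contDiffOn hU (hc k) v) hp
  match k with
  | 0 => exact dirDeriv_comm hU (hc 0) u v hp
  | 1 =>
    simp only [chainStep]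
    rw [dirDeriv_add ((hfv v).fun_mul (hc1 0)) (hcv 1 v),
      dirDeriv_add ((hfv u).fun_mul (hc1 0)) (hcv 1 u),
      dirDeriv_mul (hfv v) (hc1 0), dirDeriv_mul (hfv u) (hc1 0), dirDeriv_comm hU hf u v hp,
      dirDeriv_comm hU (hc 1) u v hp]
    ring
  | k + 2 =>
    simp only [chainStep]
    rw [dirDeriv_add ((hfv v).fun_mul (hc1 _)) (hcv _ v),
      dirDeriv_add ((hfv u).fun_mul (hc1 _)) (hcv _ u),
      dirDeriv_mul (hfv v) (hc1 _), dirDeriv_mul (hfv u) (hc1 _), dirDeriv_comm hU hf u v hp,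
      dirDeriv_comm hU (hc _) u v hp]
    ring

theorem chainCoeff_succ_left (f : ℝ × ℝ → ℝ) (a b : ℕ) :
    chainCoeff f (a + 1) b = chainStep dX f (chainCoeff f a b) := by
  simp only [chainCoeff, Function.iterate_succ_apply']

theorem chainCoeff_zero_succ (f : ℝ × ℝ → ℝ) (b : ℕ) :
    chainCoeff f 0 (b + 1) = chainStep dY f (chainCoeff f 0 b) := by
  simp only [chainCoeff, Function.iterate_succ_apply', Function.iterate_zero, id_eq]

/-- An induction principle for statements about `chainCoeff` that are stable under `chainStep`. -/
theorem chainCoeff_induction (f : ℝ × ℝ → ℝ) (Q : ℕ → ℕ → (ℕ → ℝ × ℝ → ℝ) → Prop)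
    (zero : Q 0 0 (fun k _ => if k = 0 then 1 else 0))
    (right : ∀ b c, Q 0 b c → Q 0 (b + 1) (chainStep dY f c))
    (left : ∀ a b c, Q a b c → Q (a + 1) b (chainStep dX f c)) (a b : ℕ) :
    Q a b (chainCoeff f a b) := by
  induction a with
  | zero =>
    induction b with
    | zero => exact zero
    | succ b ih => rw [chainCoeff_zero_succ]; exact right b _ ih
  | succ a ih => rw [chainCoeff_succ_left]; exact left a b _ ih

theorem chainCoeff_contDiffOn {U : Set (ℝ × ℝ)} (hU : IsOpen U) {f : ℝ × ℝ → ℝ}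
    (hf : ContDiffOn ℝ ∞ f U) (a b k : ℕ) : ContDiffOn ℝ ∞ (chainCoeff f a b k) U := by
  refine chainCoeff_induction f (fun _ _ c => ∀ k, ContDiffOn ℝ ∞ (c k) U)
    (fun _ => contDiffOn_const) ?_ ?_ a b k
  · exact fun _ _ hc => chainStep_contDiffOn hU hf dY hc
  · exact fun _ _ _ hc => chainStep_contDiffOn hU hf dX hc

theorem chainCoeff_succ_right {U : Set (ℝ × ℝ)} (hU : IsOpen U) {f : ℝ × ℝ → ℝ}
    (hf : ContDiffOn ℝ ∞ f U) (a b k : ℕ) :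
    U.EqOn (chainCoeff f a (b + 1) k) (chainStep dY f (chainCoeff f a b) k) := by
  induction a generalizing k with
  | zero => rw [chainCoeff_zero_succ]; exact fun _ _ => rfl
  | succ a ih =>
    rw [chainCoeff_succ_left, chainCoeff_succ_left]
    exact (chainStep_congr hU f dX ih k).trans
      (chainStep_comm hU hf dX dY (chainCoeff_contDiffOn hU hf a b) k)

theorem chainCoeff_of_lt (f : ℝ × ℝ → ℝ) {a b k : ℕ} (h : a + b < k) :
    chainCoeff f a b k = fun _ => 0 := by
  have step (v : ℝ × ℝ) (n : ℕ) (c : ℕ → ℝ × ℝ → ℝ) (hc : ∀ k, n < k → c k = fun _ => 0) :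
      ∀ k, n + 1 < k → chainStep v f c k = fun _ => 0 := by
    intro k hk
    obtain ⟨k, rfl⟩ : ∃ l, k = l + 1 := ⟨k - 1, by omega⟩
    ext p
    simp [chainStep, hc k (by omega), hc (k + 1) (by omega), dirDeriv_const]
  refine chainCoeff_induction f (fun a b c => ∀ k, a + b < k → c k = fun _ => 0) ?_ ?_ ?_ a b k h
  · intro k hk
    simp [show k ≠ 0 by omega]
  · exact fun b c hc k hk => step dY (0 + b) c hc k (by omega)
  · exact fun a b c hc k hk => step dX (a + b) c hc k (by omega)

theorem chainCoeff_zero (f : ℝ × ℝ → ℝ) {a b : ℕ} (h : 0 < a + b) :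
    chainCoeff f a b 0 = fun _ => 0 := by
  have step (v : ℝ × ℝ) (c : ℕ → ℝ × ℝ → ℝ) (hc : ∃ x, c 0 = fun _ => x) :
      chainStep v f c 0 = fun _ => 0 := by
    obtain ⟨x, hx⟩ := hc
    ext p
    simp [chainStep, hx, dirDeriv_const]
  -- At `a + b = 0` the coefficient is `1`, not `0`; constancy is carried along so that the first
  -- derivative kills it.
  refine (chainCoeff_induction f
    (fun a b c => (∃ x, c 0 = fun _ => x) ∧ (0 < a + b → c 0 = fun _ => 0)) ?_ ?_ ?_ a b).2 h
  · exact ⟨⟨1, by simp⟩, by simp⟩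
  · exact fun b c hc => ⟨⟨0, step dY c hc.1⟩, fun _ => step dY c hc.1⟩
  · exact fun a b c hc => ⟨⟨0, step dX c hc.1⟩, fun _ => step dX c hc.1⟩

theorem chainCoeff_top (f : ℝ × ℝ → ℝ) (a b : ℕ) (p : ℝ × ℝ) :
    chainCoeff f a b (a + b) p = dirDeriv dX f p ^ a * dirDeriv dY f p ^ b := by
  induction a with
  | zero =>
    induction b with
    | zero => simp [chainCoeff]
    | succ b ih =>
      rw [chainCoeff_zero_succ, ← Nat.add_assoc]
      simp only [chainStep]
      rw [chainCoeff_of_lt f (show 0 + b < 0 + b + 1 by omega), dirDeriv_const, ih]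
      ring
  | succ a ih =>
    rw [chainCoeff_succ_left, show a + 1 + b = a + b + 1 by omega]
    simp only [chainStep]
    rw [chainCoeff_of_lt f (show a + b < a + b + 1 by omega), dirDeriv_const, ih]
    ring

/-! ### Invertibility of the matrices of the web -/

theorem wedge_eq (g h : ℝ × ℝ → ℝ) (p : ℝ × ℝ) : wedge (fderiv ℝ g) (fderiv ℝ h) p =
    dirDeriv dX g p * dirDeriv dY h p - dirDeriv dY g p * dirDeriv dX h p := rfl

theorem block_top {d : ℕ} (f : Fin d → ℝ × ℝ → ℝ) (k : ℕ) (p : ℝ × ℝ) (i : Fin (k + 1))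
    (j : Fin d) : block f (k + 1) k p i j =
      dirDeriv dX (f j) p ^ (k - i : ℕ) * dirDeriv dY (f j) p ^ (i : ℕ) := by
  have h : k - i + i = k := by omega
  have := chainCoeff_top (f j) (k - i) i p
  rw [h] at this
  simpa [block] using this

/-- The first `k + 1` columns form, up to transposition, a projective Vandermonde matrix at the
points `[f_{j,y} : f_{j,x}]`, which are distinct by transversality. -/
theorem IsWeb.eq_zero_of_block_top {d : ℕ} {U : Set (ℝ × ℝ)} {f : Fin d → ℝ × ℝ → ℝ}
    (hf : IsWeb U f) {p : ℝ × ℝ} (hp : p ∈ U) {k : ℕ} (hk : k < d) (c : Fin (k + 1) → ℝ)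
    (hc : ∀ j, ∑ i, c i * block f (k + 1) k p i j = 0) : c = 0 := by
  let V : Matrix (Fin (k + 1)) (Fin (k + 1)) ℝ := Matrix.projVandermonde
    (fun j => dirDeriv dY (f (Fin.castLE hk j)) p) (fun j => dirDeriv dX (f (Fin.castLE hk j)) p)
  have hdet : V.det ≠ 0 := by
    rw [Matrix.det_projVandermonde]
    refine Finset.prod_ne_zero_iff.mpr fun i _ => Finset.prod_ne_zero_iff.mpr fun j hj => ?_
    have hij : i < j := Finset.mem_Ioi.mp hj
    have := hf.transverse p hp (Fin.castLE hk i) (Fin.castLE hk j)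
      (fun h => hij.ne (Fin.castLE_injective hk h))
    rw [wedge_eq] at this
    convert this using 1
    ring
  refine Matrix.eq_zero_of_mulVec_eq_zero hdet ?_
  ext j
  rw [Matrix.mulVec, dotProduct, Pi.zero_apply, ← hc (Fin.castLE hk j)]
  refine Finset.sum_congr rfl fun i _ => ?_
  simp only [V]
  rw [block_top, Matrix.projVandermonde_apply, Fin.val_rev, show k + 1 - (i + 1) = k - i by omega]
  ring

theorem IsWeb.det_matP_ne_zero {d : ℕ} {U : Set (ℝ × ℝ)} {f : Fin d → ℝ × ℝ → ℝ}
    (hf : IsWeb U f) {p : ℝ × ℝ} (hp : p ∈ U) : (matP f d p).det ≠ 0 := by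
  cases d with
  | zero => simp
  | succ k =>
    intro h
    obtain ⟨c, hc, h0⟩ := Matrix.exists_vecMul_eq_zero_iff.mpr h
    exact hc (hf.eq_zero_of_block_top hp (Nat.lt_succ_self k) c fun j => congrFun h0 j)

/-- Elimination from the last block row upwards: in block column `r`, the rows above vanish by
triangularity, those below have zero coefficients by induction, and the diagonal block `P_{r+2}` has
independent rows. -/
theorem IsWeb.eq_zero_of_vecMul_matMM {d : ℕ} {U : Set (ℝ × ℝ)} {f : Fin d → ℝ × ℝ → ℝ}
    (hf : IsWeb U f) {p : ℝ × ℝ} (hp : p ∈ U) (c : (Σ r : Fin (d - 2), Fin ((r : ℕ) + 2)) → ℝ)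
    (hc : Matrix.vecMul c (matMM f p) = 0) : c = 0 := by
  suffices ∀ n (r : Fin (d - 2)), d - 2 - r = n → ∀ i, c ⟨r, i⟩ = 0 by
    ext ⟨r, i⟩
    exact this _ r rfl i
  intro n
  induction n using Nat.strong_induction_on with
  | _ n ih =>
    intro r hr
    refine congrFun (hf.eq_zero_of_block_top hp (k := r + 1) (by omega) (fun i => c ⟨r, i⟩) ?_)
    intro j
    have h := congrFun hc (r, j)
    rw [Pi.zero_apply, Matrix.vecMul, dotProduct, Fintype.sum_sigma] at h
    rw [Finset.sum_eq_single r] at h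
    · exact h
    · intro r' _ hne
      refine Finset.sum_eq_zero fun i _ => ?_
      rcases lt_or_gt_of_ne hne with hlt | hgt
      · have hlt : (r' : ℕ) < r := hlt
        have : matMM f p ⟨r', i⟩ (r, j) = 0 := by
          simp only [matMM, block, Matrix.of_apply]
          rw [chainCoeff_of_lt _ (by omega)]
        rw [this, mul_zero]
      · have hgt : (r : ℕ) < r' := hgt
        rw [ih (d - 2 - r') (by omega) r' rfl i, zero_mul]
    · simp

theorem IsWeb.finrank_fiber {d : ℕ} (hd : 3 ≤ d) {U : Set (ℝ × ℝ)} {f : Fin d → ℝ × ℝ → ℝ}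
    (hf : IsWeb U f) {p : ℝ × ℝ} (hp : p ∈ U) :
    Module.finrank ℝ (fiber f p) = (d - 1) * (d - 2) / 2 := by
  have hli : LinearIndependent ℝ (matMM f p).row := by
    rw [← Matrix.vecMul_injective_iff]
    refine (injective_iff_map_eq_zero (Matrix.vecMulLinear (matMM f p))).mpr ?_
    exact hf.eq_zero_of_vecMul_matMM hp
  have hr := hli.rank_matrix
  have hk := LinearMap.finrank_range_add_finrank_ker (matMM f p).mulVecLin
  change (matMM f p).rank + Module.finrank ℝ (fiber f p) = _ at hk
  rw [hr] at hk
  simp only [Fintype.card_sigma, Fintype.card_fin, Module.finrank_fintype_fun_eq_card,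
    Fintype.card_prod] at hk
  rw [Fin.sum_univ_eq_sum_range (fun r => r + 2) (d - 2)] at hk
  obtain ⟨n, rfl⟩ : ∃ n, d = n + 2 := ⟨d - 2, by omega⟩
  simp only [Nat.add_sub_cancel, show n + 2 - 1 = n + 1 by omega] at hk ⊢
  have hs : (∑ r ∈ Finset.range n, (r + 2)) * 2 = n * (n + 3) := by
    clear * -
    induction n with
    | zero => simp
    | succ n ih => rw [Finset.sum_range_succ, add_mul, ih]; ring
  symm
  apply Nat.div_eq_of_eq_mul_left two_pos
  nlinarith

/-- A Gram matrix of independent rows: `c ⬝ M Mᵀ c = |Mᵀ c|²`. It serves to project smoothly onto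
`ker MM`. -/
theorem IsWeb.det_matMM_mul_transpose_ne_zero {d : ℕ} {U : Set (ℝ × ℝ)}
    {f : Fin d → ℝ × ℝ → ℝ} (hf : IsWeb U f) {p : ℝ × ℝ} (hp : p ∈ U) :
    (matMM f p * (matMM f p).transpose).det ≠ 0 := by
  intro h
  obtain ⟨c, hc, h0⟩ := Matrix.exists_mulVec_eq_zero_iff.mpr h
  refine hc (hf.eq_zero_of_vecMul_matMM hp c ?_)
  have h1 : c ⬝ᵥ (matMM f p * (matMM f p).transpose).mulVec c = 0 := by rw [h0]; simp
  rw [← Matrix.mulVec_mulVec, Matrix.dotProduct_mulVec, Matrix.mulVec_transpose] at h1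
  exact dotProduct_self_eq_zero.mp h1

/-! ### Smoothness of the matrices of the web, and smooth sections of `ker MM`. -/

theorem contDiffOn_det {U : Set (ℝ × ℝ)} {n : Type*} [Fintype n] [DecidableEq n]
    {A : ℝ × ℝ → Matrix n n ℝ} (hA : ∀ i j, ContDiffOn ℝ ∞ (fun q => A q i j) U) :
    ContDiffOn ℝ ∞ (fun q => (A q).det) U := by
  simp only [Matrix.det_apply']
  exact ContDiffOn.sum fun σ _ => contDiffOn_const.mul (contDiffOn_prod fun i _ => hA _ _)

theorem contDiffOn_matrix_inv {U : Set (ℝ × ℝ)} {n : Type*} [Fintype n] [DecidableEq n]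
    {A : ℝ × ℝ → Matrix n n ℝ} (hA : ∀ i j, ContDiffOn ℝ ∞ (fun q => A q i j) U)
    (hdet : ∀ q ∈ U, (A q).det ≠ 0) (i j : n) :
    ContDiffOn ℝ ∞ (fun q => (A q)⁻¹ i j) U := by
  simp only [Matrix.inv_def, Ring.inverse_eq_inv', Matrix.smul_apply, smul_eq_mul,
    Matrix.adjugate_apply]
  refine ((contDiffOn_det hA).inv hdet).mul (contDiffOn_det fun k l => ?_)
  by_cases hk : k = j
  · subst hk
    simpa using contDiffOn_const
  · simpa [Matrix.updateRow_apply, hk] using hA k l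

theorem contDiffOn_matrix_mul {U : Set (ℝ × ℝ)} {l m n : Type*} [Fintype m]
    {A : ℝ × ℝ → Matrix l m ℝ} {B : ℝ × ℝ → Matrix m n ℝ}
    (hA : ∀ i j, ContDiffOn ℝ ∞ (fun q => A q i j) U)
    (hB : ∀ i j, ContDiffOn ℝ ∞ (fun q => B q i j) U) (i : l) (j : n) :
    ContDiffOn ℝ ∞ (fun q => (A q * B q) i j) U := by
  simp only [Matrix.mul_apply]
  exact ContDiffOn.sum fun k _ => (hA i k).mul (hB k j)

section Smooth

variable {d : ℕ} {U : Set (ℝ × ℝ)} {f : Fin d → ℝ × ℝ → ℝ}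

theorem IsWeb.contDiffOn_block (hU : IsOpen U) (hf : IsWeb U f) (r k : ℕ) (i : Fin r)
    (j : Fin d) : ContDiffOn ℝ ∞ (fun q => block f r k q i j) U :=
  chainCoeff_contDiffOn hU (hf.smooth j) _ _ _

theorem IsWeb.contDiffOn_matMM (hU : IsOpen U) (hf : IsWeb U f)
    (ri : Σ r : Fin (d - 2), Fin ((r : ℕ) + 2)) (kj : Idx d) :
    ContDiffOn ℝ ∞ (fun q => matMM f q ri kj) U :=
  hf.contDiffOn_block hU _ _ _ _

theorem IsWeb.contDiffOn_matA (hU : IsOpen U) (hf : IsWeb U f) (m : ℕ) (i j : Fin d) :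
    ContDiffOn ℝ ∞ (fun q => matA f m q i j) U :=
  (contDiffOn_matrix_mul (contDiffOn_matrix_inv (hf.contDiffOn_block hU d (d - 1))
    fun _ hq => hf.det_matP_ne_zero hq) (hf.contDiffOn_block hU d (d - m)) i j).neg

theorem IsWeb.contDiffOn_matDelta (hU : IsOpen U) (hf : IsWeb U f) (ki lj : Idx d) :
    ContDiffOn ℝ ∞ (fun q => matDelta f q ki lj) U := by
  simp only [matDelta, Matrix.of_apply]
  split_ifs
  · exact contDiffOn_const
  · exact contDiffOn_const
  · exact hf.contDiffOn_matA hU _ _ _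

theorem IsWeb.contDiffOn_matDeltaDir (hU : IsOpen U) (hf : IsWeb U f) (v : ℝ × ℝ)
    (ki lj : Idx d) : ContDiffOn ℝ ∞ (fun q => matDeltaDir f v q ki lj) U := by
  simp only [matDeltaDir, Matrix.diagonal_mul]
  exact (dirDeriv_contDiffOn hU (hf.smooth ki.2) v).mul (hf.contDiffOn_matDelta hU ki lj)

/-- The section is the orthogonal projection of the constant `w` onto the kernel, `w - Mᵀ (M Mᵀ)⁻¹ M
w`. Such sections make the curvature endomorphism unique. -/
theorem IsWeb.exists_isSection (hU : IsOpen U) (hf : IsWeb U f) {p : ℝ × ℝ}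
    {w : Idx d → ℝ} (hw : w ∈ fiber f p) : ∃ s, IsSection f U s ∧ s p = w := by
  have hw : (matMM f p).mulVec w = 0 := hw
  let M := matMM f
  let N : ℝ × ℝ → Matrix _ (Idx d) ℝ := fun q =>
    (M q).transpose * (M q * (M q).transpose)⁻¹ * M q
  have hN : ∀ i j, ContDiffOn ℝ ∞ (fun q => N q i j) U := by
    have hM := hf.contDiffOn_matMM hU
    refine contDiffOn_matrix_mul (contDiffOn_matrix_mul (fun i j => hM j i) ?_) hM
    exact contDiffOn_matrix_inv (contDiffOn_matrix_mul hM fun i j => hM j i)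
      fun q hq => hf.det_matMM_mul_transpose_ne_zero hq
  refine ⟨fun q => w - (N q).mulVec w, ⟨?_, fun q hq => ?_⟩, ?_⟩
  · refine contDiffOn_const.sub (contDiffOn_pi.mpr fun i => ?_)
    exact ContDiffOn.sum fun j _ => (hN i j).mul contDiffOn_const
  · change (M q).mulVec _ = 0
    have hdet := hf.det_matMM_mul_transpose_ne_zero hq
    rw [Matrix.mulVec_sub, Matrix.mulVec_mulVec, ← Matrix.mul_assoc, ← Matrix.mul_assoc,
      Matrix.mul_nonsing_inv _ (isUnit_iff_ne_zero.mpr hdet), Matrix.one_mul, sub_self]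
  · simp only [N, M]
    rw [← Matrix.mulVec_mulVec, hw]
    simp

end Smooth

/-! ### The equations of an abelian relation and the connection -/

section Connection

variable {d : ℕ} {U : Set (ℝ × ℝ)} {f : Fin d → ℝ × ℝ → ℝ}

/-- The vector `ω^{d-1}` determined by `w = (ω^1, …, ω^{d-2})` through the equations of
order `d - 1`. -/
def lastRow (f : Fin d → ℝ × ℝ → ℝ) (p : ℝ × ℝ) (w : Idx d → ℝ) : Fin d → ℝ := fun i =>
  ∑ lj : Idx d, matA f (d - 1 - lj.1) p i lj.2 * w lj

/-- The sequence `ω^1, …, ω^{d-1}`, extended by zero. -/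
def extSeq (f : Fin d → ℝ × ℝ → ℝ) (p : ℝ × ℝ) (w : Idx d → ℝ) (k : ℕ) (i : Fin d) : ℝ :=
  -- Truncated subtraction can bring `k = 0` here; its value is immaterial in equations of positive
  -- order, since `C_{a,b,0} = 0`.
  if h : k - 1 < d - 2 then (if k = 0 then 0 else w (⟨k - 1, h⟩, i))
  else if k = d - 1 then lastRow f p w i else 0

/-- The equation obtained from `∑ i, h_i(f_i) = 0` by applying `∂_x^a ∂_y^b`. -/
def jetEq (f : Fin d → ℝ × ℝ → ℝ) (a b : ℕ) (p : ℝ × ℝ) (w : Idx d → ℝ) : ℝ :=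
  ∑ i, ∑ k ∈ Finset.range d, chainCoeff (f i) a b k p * extSeq f p w k i

theorem extSeq_succ (p : ℝ × ℝ) (w : Idx d → ℝ) (k : Fin (d - 2)) (i : Fin d) :
    extSeq f p w (k + 1) i = w (k, i) := by
  have : (k : ℕ) + 1 - 1 < d - 2 := by omega
  rw [extSeq, dif_pos this, if_neg (by omega)]
  simp

theorem extSeq_last (hd : 3 ≤ d) (p : ℝ × ℝ) (w : Idx d → ℝ) (i : Fin d) :
    extSeq f p w (d - 1) i = lastRow f p w i := by
  rw [extSeq, dif_neg (by omega), if_pos rfl]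

theorem matDelta_mulVec (hd : 3 ≤ d) (p : ℝ × ℝ) (w : Idx d → ℝ) (k : Fin (d - 2)) (i : Fin d) :
    (matDelta f p).mulVec w (k, i) = extSeq f p w (k + 2) i := by
  by_cases h : (k : ℕ) + 1 < d - 2
  · have h2 := extSeq_succ (f := f) p w ⟨k + 1, h⟩ i
    simp only at h2
    rw [show (k : ℕ) + 2 = k + 1 + 1 by ring, h2]
    simp only [Matrix.mulVec, dotProduct, matDelta, Matrix.of_apply]
    rw [Finset.sum_eq_single (⟨k + 1, h⟩, i)]
    · simp [h]
    · rintro ⟨l, j⟩ _ hne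
      rw [if_pos h, if_neg, zero_mul]
      rintro ⟨h1, rfl⟩
      exact hne (by simp only [Prod.mk.injEq, and_true]; exact Fin.ext h1)
    · simp
  · rw [show (k : ℕ) + 2 = d - 1 by omega, extSeq_last hd]
    simp only [Matrix.mulVec, dotProduct, matDelta, Matrix.of_apply, if_neg h, lastRow]

theorem nabla_apply (hd : 3 ≤ d) (v : ℝ × ℝ) {s : ℝ × ℝ → Idx d → ℝ} {p : ℝ × ℝ}
    (hs : DifferentiableAt ℝ s p) (k : Fin (d - 2)) (i : Fin d) :
    nabla f v s p (k, i) =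
      dirDeriv v (fun q => s q (k, i)) p - dirDeriv v (f i) p * extSeq f p (s p) (k + 2) i := by
  simp only [nabla, matDeltaDir, Pi.sub_apply]
  rw [← Matrix.mulVec_mulVec, Matrix.mulVec_diagonal, matDelta_mulVec hd]
  simp only [dirDeriv, fderiv_apply hs (k, i)]
  rfl

/-- The sum over the orders `1, …, d - 2` only. -/
theorem jetEq_eq_sum (hd : 3 ≤ d) {a b : ℕ} (h0 : 0 < a + b) (h : a + b ≤ d - 2)
    (p : ℝ × ℝ) (w : Idx d → ℝ) : jetEq f a b p w =
      ∑ i, ∑ k : Fin (d - 2), chainCoeff (f i) a b (k + 1) p * w (k, i) := by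
  refine Finset.sum_congr rfl fun i _ => ?_
  rw [show Finset.range d = Finset.range (d - 2 + 1 + 1) by congr 1; omega,
    Finset.sum_range_succ, Finset.sum_range_succ', chainCoeff_zero _ h0,
    chainCoeff_of_lt _ (show a + b < d - 2 + 1 by omega), zero_mul, zero_mul,
    add_zero, add_zero, Finset.sum_range]
  refine Finset.sum_congr rfl fun k _ => ?_
  congr 1
  exact extSeq_succ p w k i

theorem jetEq_eq_block (hd : 3 ≤ d) (r i : ℕ) (hi : i ≤ r) (h : r ≤ d - 2) (h0 : 0 < r)
    (p : ℝ × ℝ) (w : Idx d → ℝ) : jetEq f (r - i) i p w =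
      ∑ kj : Idx d, chainCoeff (f kj.2) (r - i) i (kj.1 + 1) p * w kj := by
  rw [jetEq_eq_sum hd (by omega) (by omega), Fintype.sum_prod_type, Finset.sum_comm]

theorem matMM_mulVec (hd : 3 ≤ d) (p : ℝ × ℝ) (w : Idx d → ℝ) (r : Fin (d - 2))
    (i : Fin ((r : ℕ) + 2)) :
    (matMM f p).mulVec w ⟨r, i⟩ = jetEq f (r + 1 - i) i p w := by
  rw [jetEq_eq_block hd (r + 1) i (by omega) (by omega) (by omega)]
  rfl

theorem mem_fiber_iff (hd : 3 ≤ d) {p : ℝ × ℝ} {w : Idx d → ℝ} :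
    w ∈ fiber f p ↔ ∀ a b, 0 < a + b → a + b ≤ d - 2 → jetEq f a b p w = 0 := by
  change (matMM f p).mulVec w = 0 ↔ _
  constructor
  · intro h a b h0 h1
    have := congrFun h ⟨⟨a + b - 1, by omega⟩, ⟨b, by simp only; omega⟩⟩
    rw [matMM_mulVec hd] at this
    simp only [Pi.zero_apply, show a + b - 1 + 1 - b = a by omega] at this
    exact this
  · intro h
    ext ⟨r, i⟩
    rw [matMM_mulVec hd]
    exact h _ _ (by omega) (by omega)

/-- Multiplying `lastRow` by `P_d` cancels the inverse in `A_m = -P_d⁻¹ G_d^m`. The vector `w` is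
arbitrary, not only in the fibre; this is what controls the curvature outside `ker MM`. -/
theorem IsWeb.jetEq_top (hd : 3 ≤ d) (hf : IsWeb U f) {p : ℝ × ℝ} (hp : p ∈ U) {a b : ℕ}
    (h : a + b = d - 1) (w : Idx d → ℝ) : jetEq f a b p w = 0 := by
  have hdet := isUnit_iff_ne_zero.mpr (hf.det_matP_ne_zero hp)
  have ha : a = d - 1 - b := by omega
  have hlast : (matP f d p).mulVec (lastRow f p w) ⟨b, by omega⟩ =
      -∑ i, ∑ k : Fin (d - 2), chainCoeff (f i) a b (k + 1) p * w (k, i) := by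
    have h1 : lastRow f p w =
        ∑ k : Fin (d - 2), (matA f (d - 1 - k) p).mulVec fun j => w (k, j) := by
      ext i
      rw [lastRow, Fintype.sum_prod_type, Finset.sum_apply]
      rfl
    rw [h1, Matrix.mulVec_sum, Finset.sum_apply, Finset.sum_comm, ← Finset.sum_neg_distrib]
    refine Finset.sum_congr rfl fun k _ => ?_
    rw [Matrix.mulVec_mulVec, matA, Matrix.mul_neg, ← Matrix.mul_assoc,
      Matrix.mul_nonsing_inv _ hdet, Matrix.one_mul, Matrix.neg_mulVec, Pi.neg_apply]
    rw [Matrix.mulVec, dotProduct]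
    congr 1
    refine Finset.sum_congr rfl fun i _ => ?_
    simp only [matG, block, Matrix.of_apply]
    rw [← ha, show d - (d - 1 - (k : ℕ)) = k + 1 by omega]
  have hsplit : jetEq f a b p w = (∑ i, ∑ k : Fin (d - 2),
      chainCoeff (f i) a b (k + 1) p * w (k, i)) +
        (matP f d p).mulVec (lastRow f p w) ⟨b, by omega⟩ := by
    rw [jetEq, Matrix.mulVec, dotProduct, ← Finset.sum_add_distrib]
    refine Finset.sum_congr rfl fun i _ => ?_
    rw [show Finset.range d = Finset.range (d - 2 + 1 + 1) by congr 1; omega,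
      Finset.sum_range_succ, Finset.sum_range_succ', chainCoeff_zero _ (show 0 < a + b by omega),
      zero_mul, add_zero, Finset.sum_range, show d - 2 + 1 = d - 1 by omega, extSeq_last hd]
    simp only [matP, block, Matrix.of_apply, ← ha, extSeq_succ]
  rw [hsplit, hlast, add_neg_cancel]

theorem IsWeb.contDiffOn_lastRow (hU : IsOpen U) (hf : IsWeb U f) {V : Set (ℝ × ℝ)} (hV : V ⊆ U)
    {s : ℝ × ℝ → Idx d → ℝ} (hs : ContDiffOn ℝ ∞ s V) (i : Fin d) :
    ContDiffOn ℝ ∞ (fun q => lastRow f q (s q) i) V :=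
  ContDiffOn.sum fun j _ => ((hf.contDiffOn_matA hU _ _ _).mono hV).mul (contDiffOn_pi.mp hs j)

theorem IsWeb.contDiffOn_extSeq (hU : IsOpen U) (hf : IsWeb U f) {V : Set (ℝ × ℝ)} (hV : V ⊆ U)
    {s : ℝ × ℝ → Idx d → ℝ} (hs : ContDiffOn ℝ ∞ s V) (k : ℕ) (i : Fin d) :
    ContDiffOn ℝ ∞ (fun q => extSeq f q (s q) k i) V := by
  simp only [extSeq]
  split_ifs
  · exact contDiffOn_const
  · exact contDiffOn_pi.mp hs _
  · exact hf.contDiffOn_lastRow hU hV hs i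
  · exact contDiffOn_const

theorem IsWeb.contDiffOn_jetEq (hU : IsOpen U) (hf : IsWeb U f) {V : Set (ℝ × ℝ)} (hV : V ⊆ U)
    {s : ℝ × ℝ → Idx d → ℝ} (hs : ContDiffOn ℝ ∞ s V) (a b : ℕ) :
    ContDiffOn ℝ ∞ (fun q => jetEq f a b q (s q)) V :=
  ContDiffOn.sum fun i _ => ContDiffOn.sum fun k _ =>
    ((chainCoeff_contDiffOn hU (hf.smooth i) a b k).mono hV).mul
      (hf.contDiffOn_extSeq hU hV hs k i)

theorem IsWeb.contDiffOn_nabla (hU : IsOpen U) (hf : IsWeb U f) {V : Set (ℝ × ℝ)} (hV : V ⊆ U)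
    (hVo : IsOpen V) {s : ℝ × ℝ → Idx d → ℝ} (hs : ContDiffOn ℝ ∞ s V) (v : ℝ × ℝ) :
    ContDiffOn ℝ ∞ (nabla f v s) V := by
  refine ContDiffOn.sub ((hs.fderiv_of_isOpen hVo (m := ∞) (by simp)).clm_apply contDiffOn_const)
    (contDiffOn_pi.mpr fun i => ?_)
  exact ContDiffOn.sum fun j _ => ((hf.contDiffOn_matDeltaDir hU v i j).mono hV).mul
    (contDiffOn_pi.mp hs j)

/-- The chain rule coefficients after one more derivative in the direction `v`. -/
theorem chainStep_chainCoeff (hU : IsOpen U) {g : ℝ × ℝ → ℝ} (hg : ContDiffOn ℝ ∞ g U)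
    (v : ℝ × ℝ) (a b k : ℕ) {p : ℝ × ℝ} (hp : p ∈ U) :
    chainStep v g (chainCoeff g a b) k p =
      v.1 * chainCoeff g (a + 1) b k p + v.2 * chainCoeff g a (b + 1) k p := by
  rw [chainCoeff_succ_left, chainCoeff_succ_right hU hg a b k hp]
  cases k with
  | zero => exact dirDeriv_eq _ _ _
  | succ k =>
    simp only [chainStep]
    rw [dirDeriv_eq v g, dirDeriv_eq v (chainCoeff g a b (k + 1))]
    ring

/-- The product rule: `∂_v` of `C_k ω^k` differentiates either factor, while the equations of the
next order replace `∂_v ω^k_i` by `df_i(v) ω^{k+1}_i`. The difference is `C_k` applied to the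
components of `∇_v s`. -/
theorem IsWeb.jetEq_nabla (hd : 3 ≤ d) (hU : IsOpen U) (hf : IsWeb U f) {V : Set (ℝ × ℝ)}
    (hV : V ⊆ U) (hVo : IsOpen V) {s : ℝ × ℝ → Idx d → ℝ} (hs : ContDiffOn ℝ ∞ s V) (v : ℝ × ℝ)
    {a b : ℕ} (h0 : 0 < a + b) (h : a + b ≤ d - 2) {p : ℝ × ℝ} (hp : p ∈ V) :
    jetEq f a b p (nabla f v s p) = dirDeriv v (fun q => jetEq f a b q (s q)) p -
      (v.1 * jetEq f (a + 1) b p (s p) + v.2 * jetEq f a (b + 1) p (s p)) := by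
  have hsd := ContDiffOn.differentiableAt_of_isOpen hVo hs hp
  have hsk (j : Idx d) : DifferentiableAt ℝ (fun q => s q j) p := differentiableAt_pi.mp hsd j
  have hC (i k) : DifferentiableAt ℝ (chainCoeff (f i) a b k) p :=
    ContDiffOn.differentiableAt_of_isOpen hU (chainCoeff_contDiffOn hU (hf.smooth i) a b k) (hV hp)
  have hderiv : dirDeriv v (fun q => jetEq f a b q (s q)) p =
      ∑ i, ∑ k : Fin (d - 2), (dirDeriv v (chainCoeff (f i) a b (k + 1)) p * s p (k, i) +
        chainCoeff (f i) a b (k + 1) p * dirDeriv v (fun q => s q (k, i)) p) := by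
    simp only [jetEq_eq_sum hd h0 h]
    rw [dirDeriv_sum fun i _ => DifferentiableAt.fun_sum fun k _ => (hC i _).fun_mul (hsk _)]
    refine Finset.sum_congr rfl fun i _ => ?_
    rw [dirDeriv_sum fun k _ => (hC i _).fun_mul (hsk _)]
    exact Finset.sum_congr rfl fun k _ => dirDeriv_mul (hC i _) (hsk _) v
  have hstep : v.1 * jetEq f (a + 1) b p (s p) + v.2 * jetEq f a (b + 1) p (s p) =
      ∑ i, ∑ k ∈ Finset.range d, chainStep v (f i) (chainCoeff (f i) a b) k p *
        extSeq f p (s p) k i := by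
    simp only [jetEq, Finset.mul_sum, ← Finset.sum_add_distrib]
    refine Finset.sum_congr rfl fun i _ => Finset.sum_congr rfl fun k _ => ?_
    rw [chainStep_chainCoeff hU (hf.smooth i) v a b k (hV hp)]
    ring
  rw [jetEq_eq_sum hd h0 h, hderiv, hstep, ← Finset.sum_sub_distrib]
  refine Finset.sum_congr rfl fun i _ => ?_
  -- The two terms of `chainStep` lose different boundary terms: the shifted one uses `C_{a,b,0} =
  -- 0`, the differentiated one `C_{a,b,d-1} = 0`.
  have h1 : ∑ k ∈ Finset.range d, chainStep v (f i) (chainCoeff (f i) a b) k p *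
        extSeq f p (s p) k i =
      ∑ k : Fin (d - 2), dirDeriv v (f i) p * chainCoeff (f i) a b (k + 1) p *
        extSeq f p (s p) (k + 2) i +
      ∑ k : Fin (d - 2), dirDeriv v (chainCoeff (f i) a b (k + 1)) p * s p (k, i) := by
    have e1 : ∑ k ∈ Finset.range d, chainStep v (f i) (chainCoeff (f i) a b) k p *
        extSeq f p (s p) k i = ∑ k ∈ Finset.range (d - 1),
          chainStep v (f i) (chainCoeff (f i) a b) (k + 1) p * extSeq f p (s p) (k + 1) i := by
      rw [show Finset.range d = Finset.range (d - 1 + 1) by congr 1; omega,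
        Finset.sum_range_succ']
      simp only [chainStep]
      rw [chainCoeff_zero _ h0, dirDeriv_const, zero_mul, add_zero]
    rw [e1]
    simp only [chainStep, add_mul, Finset.sum_add_distrib]
    congr 1
    · rw [show Finset.range (d - 1) = Finset.range (d - 2 + 1) by congr 1; omega,
        Finset.sum_range_succ', chainCoeff_zero _ h0, mul_zero, zero_mul, add_zero,
        Finset.sum_range]
    · rw [show Finset.range (d - 1) = Finset.range (d - 2 + 1) by congr 1; omega,
        Finset.sum_range_succ, chainCoeff_of_lt _ (show a + b < d - 2 + 1 by omega),
        dirDeriv_const, zero_mul, add_zero, Finset.sum_range]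
      exact Finset.sum_congr rfl fun k _ => by rw [extSeq_succ]
  rw [h1, ← Finset.sum_add_distrib, ← Finset.sum_sub_distrib]
  refine Finset.sum_congr rfl fun k _ => ?_
  rw [nabla_apply hd v hsd]
  ring

theorem IsWeb.isSection_nabla (hd : 3 ≤ d) (hU : IsOpen U) (hf : IsWeb U f) {V : Set (ℝ × ℝ)}
    (hV : V ⊆ U) (hVo : IsOpen V) {s : ℝ × ℝ → Idx d → ℝ} (hs : IsSection f V s) (v : ℝ × ℝ) :
    IsSection f V (nabla f v s) := by
  refine ⟨hf.contDiffOn_nabla hU hV hVo hs.smooth v, fun p hp => ?_⟩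
  have hz {a b : ℕ} (h0 : 0 < a + b) (h : a + b ≤ d - 1) {q : ℝ × ℝ} (hq : q ∈ V) :
      jetEq f a b q (s q) = 0 := by
    rcases h.lt_or_eq with h | h
    · exact (mem_fiber_iff hd).mp (hs.mem q hq) a b h0 (by omega)
    · exact hf.jetEq_top hd (hV hq) h _
  refine (mem_fiber_iff hd).mpr fun a b h0 h => ?_
  rw [hf.jetEq_nabla hd hU hV hVo hs.smooth v h0 h hp, hz (by omega) (by omega) hp,
    hz (by omega) (by omega) hp,
    dirDeriv_congr hVo (h := fun _ => 0) (fun q hq => hz h0 (by omega) hq) v hp,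
    dirDeriv_const]
  ring

/-- The curvature of `∇⁰` has its values in the kernel of `MM`. -/
theorem IsWeb.nabla_nabla_sub_mem_fiber (hd : 3 ≤ d) (hU : IsOpen U) (hf : IsWeb U f)
    {s : ℝ × ℝ → Idx d → ℝ} (hs : ContDiffOn ℝ ∞ s U) (u v : ℝ × ℝ) {p : ℝ × ℝ} (hp : p ∈ U) :
    nabla f u (nabla f v s) p - nabla f v (nabla f u s) p ∈ fiber f p := by
  have hn (v) := hf.contDiffOn_nabla hU subset_rfl hU hs v
  have hE (a b) := hf.contDiffOn_jetEq hU subset_rfl hs a b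
  have hEd (a b) := ContDiffOn.differentiableAt_of_isOpen hU (hE a b) hp
  have hEdd (v a b) :=
    ContDiffOn.differentiableAt_of_isOpen hU (dirDeriv_contDiffOn hU (hE a b) v) hp
  have hsub (a b : ℕ) (h0 : 0 < a + b) (h : a + b ≤ d - 2) (w w' : Idx d → ℝ) :
      jetEq f a b p (w - w') = jetEq f a b p w - jetEq f a b p w' := by
    simp only [jetEq_eq_sum hd h0 h, Pi.sub_apply, mul_sub, Finset.sum_sub_distrib]
  refine (mem_fiber_iff hd).mpr fun a b h0 h => ?_
  rw [hsub a b h0 h, hf.jetEq_nabla hd hU subset_rfl hU (hn v) u h0 h hp,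
    hf.jetEq_nabla hd hU subset_rfl hU (hn u) v h0 h hp]
  have key (u v : ℝ × ℝ) : dirDeriv u (fun q => jetEq f a b q (nabla f v s q)) p =
      dirDeriv u (dirDeriv v (fun q => jetEq f a b q (s q))) p -
        (v.1 * dirDeriv u (fun q => jetEq f (a + 1) b q (s q)) p +
          v.2 * dirDeriv u (fun q => jetEq f a (b + 1) q (s q)) p) := by
    rw [dirDeriv_congr hU (fun q hq => hf.jetEq_nabla hd hU subset_rfl hU hs v h0 h hq) u hp,
      dirDeriv_sub (hEdd v a b) (((hEd _ _).const_mul _).fun_add ((hEd _ _).const_mul _)),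
      dirDeriv_add ((hEd _ _).const_mul _) ((hEd _ _).const_mul _),
      dirDeriv_mul (differentiableAt_const _) (hEd _ _),
      dirDeriv_mul (differentiableAt_const _) (hEd _ _), dirDeriv_const, dirDeriv_const]
    ring
  rw [key, key, dirDeriv_comm hU (hE a b) u v hp]
  -- Below order `d - 2` the identity applies once more and all terms cancel by symmetry. At order
  -- `d - 2` the remaining terms have order `d - 1` and vanish identically, for any `s`.
  rcases h.lt_or_eq with h | h
  · simp only [hf.jetEq_nabla hd hU subset_rfl hU hs _ (show 0 < a + 1 + b by omega)
      (by omega) hp, hf.jetEq_nabla hd hU subset_rfl hU hs _ (show 0 < a + (b + 1) by omega)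
      (by omega) hp]
    ring
  · have hz {a' b' : ℕ} (h' : a' + b' = d - 1) (w : ℝ × ℝ) :
        dirDeriv w (fun q => jetEq f a' b' q (s q)) p = 0 := by
      rw [dirDeriv_congr hU (h := fun _ => 0) (fun q hq => hf.jetEq_top hd hq h' _) w hp,
        dirDeriv_const]
    rw [hz (by omega), hz (by omega), hz (by omega), hz (by omega),
      hf.jetEq_top hd hp (by omega), hf.jetEq_top hd hp (by omega),
      hf.jetEq_top hd hp (by omega), hf.jetEq_top hd hp (by omega)]
    ring

end Connection

/-! ### The curvature of the connection and its trace -/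

section Curvature

variable {d : ℕ} {U : Set (ℝ × ℝ)} {f : Fin d → ℝ × ℝ → ℝ}

/-- The curvature of `∇⁰`. -/
def curvatureMatrix (f : Fin d → ℝ × ℝ → ℝ) (u v p : ℝ × ℝ) : Matrix (Idx d) (Idx d) ℝ :=
  Matrix.of (fun i j => dirDeriv v (fun q => matDeltaDir f u q i j) p -
    dirDeriv u (fun q => matDeltaDir f v q i j) p) +
  (matDeltaDir f u p * matDeltaDir f v p - matDeltaDir f v p * matDeltaDir f u p)

theorem nabla_apply_eq_sum (v : ℝ × ℝ) {s : ℝ × ℝ → Idx d → ℝ} {p : ℝ × ℝ}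
    (hs : DifferentiableAt ℝ s p) (i : Idx d) :
    nabla f v s p i = dirDeriv v (fun q => s q i) p - ∑ j, matDeltaDir f v p i j * s p j := by
  simp only [nabla, Pi.sub_apply, dirDeriv, fderiv_apply hs i]
  rfl

theorem IsWeb.nabla_nabla_sub (hU : IsOpen U) (hf : IsWeb U f) {V : Set (ℝ × ℝ)} (hV : V ⊆ U)
    (hVo : IsOpen V) {s : ℝ × ℝ → Idx d → ℝ} (hs : ContDiffOn ℝ ∞ s V) (u v : ℝ × ℝ) {p : ℝ × ℝ}
    (hp : p ∈ V) : nabla f u (nabla f v s) p - nabla f v (nabla f u s) p =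
      (curvatureMatrix f u v p).mulVec (s p) := by
  have hsd {q} (hq : q ∈ V) := ContDiffOn.differentiableAt_of_isOpen hVo hs hq
  have hsj (j) : DifferentiableAt ℝ (fun q => s q j) p := differentiableAt_pi.mp (hsd hp) j
  have hsv (v j) : DifferentiableAt ℝ (dirDeriv v fun q => s q j) p :=
    ContDiffOn.differentiableAt_of_isOpen hVo
      (dirDeriv_contDiffOn hVo (contDiffOn_pi.mp hs j) v) hp
  have hD (v i j) : DifferentiableAt ℝ (fun q => matDeltaDir f v q i j) p :=
    ContDiffOn.differentiableAt_of_isOpen hU (hf.contDiffOn_matDeltaDir hU v i j) (hV hp)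
  have hnd (v) : DifferentiableAt ℝ (nabla f v s) p :=
    ContDiffOn.differentiableAt_of_isOpen hVo (hf.contDiffOn_nabla hU hV hVo hs v) hp
  have key (u v : ℝ × ℝ) (i : Idx d) : nabla f u (nabla f v s) p i =
      dirDeriv u (dirDeriv v fun q => s q i) p -
      ∑ j, dirDeriv u (fun q => matDeltaDir f v q i j) p * s p j -
      ∑ j, matDeltaDir f v p i j * dirDeriv u (fun q => s q j) p -
      ∑ j, matDeltaDir f u p i j * dirDeriv v (fun q => s q j) p +
      (matDeltaDir f u p * matDeltaDir f v p).mulVec (s p) i := by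
    rw [nabla_apply_eq_sum u (hnd v), dirDeriv_congr hVo
      (fun q hq => nabla_apply_eq_sum v (hsd hq) i) u hp, dirDeriv_sub (hsv v i)
      (DifferentiableAt.fun_sum fun j _ => (hD v i j).fun_mul (hsj j)),
      dirDeriv_sum (fun j _ => (hD v i j).fun_mul (hsj j))]
    simp only [dirDeriv_mul (hD v i _) (hsj _), Finset.sum_add_distrib,
      nabla_apply_eq_sum v (hsd hp), mul_sub, Finset.sum_sub_distrib]
    rw [← Matrix.mulVec_mulVec]
    simp only [Matrix.mulVec, dotProduct]
    ring
  ext i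
  rw [Pi.sub_apply, key, key, dirDeriv_comm hVo (contDiffOn_pi.mp hs i) u v hp, curvatureMatrix,
    Matrix.add_mulVec, Matrix.sub_mulVec, Pi.add_apply, Pi.sub_apply]
  have : (Matrix.of fun i j => dirDeriv v (fun q => matDeltaDir f u q i j) p -
      dirDeriv u (fun q => matDeltaDir f v q i j) p).mulVec (s p) i =
      ∑ j, dirDeriv v (fun q => matDeltaDir f u q i j) p * s p j -
      ∑ j, dirDeriv u (fun q => matDeltaDir f v q i j) p * s p j := by
    simp only [Matrix.mulVec, dotProduct, Matrix.of_apply, sub_mul, Finset.sum_sub_distrib]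
  rw [this]
  ring

/-- The commutator is traceless. -/
theorem IsWeb.trace_curvatureMatrix (hU : IsOpen U) (hf : IsWeb U f) (u v : ℝ × ℝ) {p : ℝ × ℝ}
    (hp : p ∈ U) : (curvatureMatrix f u v p).trace =
      dirDeriv v (fun q => (matDeltaDir f u q).trace) p -
        dirDeriv u (fun q => (matDeltaDir f v q).trace) p := by
  have hD (v i j) : DifferentiableAt ℝ (fun q => matDeltaDir f v q i j) p :=
    ContDiffOn.differentiableAt_of_isOpen hU (hf.contDiffOn_matDeltaDir hU v i j) hp
  rw [curvatureMatrix, Matrix.trace_add, Matrix.trace_sub, Matrix.trace_mul_comm, sub_self,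
    add_zero]
  simp only [Matrix.trace, Matrix.diag_apply, Matrix.of_apply, Finset.sum_sub_distrib]
  rw [dirDeriv_sum fun i _ => hD u i i, dirDeriv_sum fun i _ => hD v i i]

/-- The identity blocks of `Δ` lie strictly above the diagonal, so only the last diagonal block
`A_2` contributes. -/
theorem trace_matDeltaDir (hd : 3 ≤ d) (v p : ℝ × ℝ) : (matDeltaDir f v p).trace =
    ∑ i, dirDeriv v (f i) p * matA f 2 p i i := by
  simp only [Matrix.trace, Matrix.diag_apply, matDeltaDir, Matrix.diagonal_mul]
  rw [Fintype.sum_prod_type, Finset.sum_eq_single ⟨d - 3, by omega⟩]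
  · refine Finset.sum_congr rfl fun i _ => ?_
    simp only [matDelta, Matrix.of_apply]
    rw [if_neg (by omega), show d - 1 - (d - 3) = 2 by omega]
  · intro k _ hk
    refine Finset.sum_eq_zero fun i _ => ?_
    have hk : (k : ℕ) ≠ d - 3 := fun h => hk (Fin.ext h)
    simp only [matDelta, Matrix.of_apply]
    rw [if_pos (by omega), if_neg (by omega), mul_zero]
  · simp

/-- `K` is the restriction of the curvature matrix of `∇⁰`. Since that matrix has its whole range in
the fibre, restricting does not change the trace. -/
theorem IsWeb.exists_isCurvatureAt (hd : 3 ≤ d) (hU : IsOpen U) (hf : IsWeb U f) {p : ℝ × ℝ}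
    (hp : p ∈ U) (u v : ℝ × ℝ) : ∃ K : Module.End ℝ (fiber f p), IsCurvatureAt f p u v K ∧
      (∀ K', IsCurvatureAt f p u v K' → K' = K) ∧
      LinearMap.trace ℝ (fiber f p) K = (curvatureMatrix f u v p).trace := by
  have hmem (w : Idx d → ℝ) : (curvatureMatrix f u v p).mulVecLin w ∈ fiber f p := by
    have hs : ContDiffOn ℝ ∞ (fun _ : ℝ × ℝ => w) U := contDiffOn_const
    have := hf.nabla_nabla_sub_mem_fiber hd hU hs u v hp
    rwa [hf.nabla_nabla_sub hU subset_rfl hU hs u v hp] at this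
  have hK : IsCurvatureAt f p u v
      ((curvatureMatrix f u v p).mulVecLin.restrict fun w (_ : w ∈ fiber f p) => hmem w) := by
    intro V hVo hpV s hs
    -- `V` may leave `U`; the curvature at `p` is computed on `V ∩ U`.
    have hs' : ContDiffOn ℝ ∞ s (V ∩ U) := hs.smooth.mono Set.inter_subset_left
    rw [hf.nabla_nabla_sub hU Set.inter_subset_right (hVo.inter hU) hs' u v ⟨hpV, hp⟩]
    rfl
  refine ⟨_, hK, fun K' hK' => ?_, ?_⟩
  · ext1 ⟨w, hw⟩
    obtain ⟨s, hs, rfl⟩ := hf.exists_isSection hU hw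
    exact Subtype.ext ((hK' U hU hp s hs).trans (hK U hU hp s hs).symm)
  · rw [LinearMap.trace_restrict_eq_of_forall_mem _ _ hmem, ← Matrix.trace_toLin'_eq]
    rfl

end Curvature

/-! ### The diagonal of the matrix `P_d⁻¹ G_d²` -/

/-- The chain rule coefficients of `∂_{v_1} ⋯ ∂_{v_n} (h ∘ g)` for constant vector fields `v_i`. -/
def chainList (g : ℝ × ℝ → ℝ) : List (ℝ × ℝ) → ℕ → ℝ × ℝ → ℝ
  | [] => chainCoeff g 0 0
  | v :: L => chainStep v g (chainList g L)

theorem chainStep_const_mul_sum {U : Set (ℝ × ℝ)} (hU : IsOpen U) (g : ℝ × ℝ → ℝ)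
    (v : ℝ × ℝ) {S : Finset ℕ} (a : ℕ → ℝ)
    {c : ℕ → ℕ → ℝ × ℝ → ℝ} (hc : ∀ m k, ContDiffOn ℝ ∞ (c m k) U) (k : ℕ) {p : ℝ × ℝ}
    (hp : p ∈ U) : chainStep v g (fun k q => ∑ m ∈ S, a m * c m k q) k p =
      ∑ m ∈ S, a m * chainStep v g (c m) k p := by
  have hcd (m k) : DifferentiableAt ℝ (c m k) p :=
    ContDiffOn.differentiableAt_of_isOpen hU (hc m k) hp
  have key (k : ℕ) : dirDeriv v (fun q => ∑ m ∈ S, a m * c m k q) p =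
      ∑ m ∈ S, a m * dirDeriv v (c m k) p := by
    rw [dirDeriv_sum fun m _ => (hcd m k).const_mul (a m)]
    refine Finset.sum_congr rfl fun m _ => ?_
    rw [dirDeriv_mul (differentiableAt_const _) (hcd m k), dirDeriv_const, zero_mul, zero_add]
  cases k with
  | zero => exact key 0
  | succ k =>
    simp only [chainStep]
    rw [key, Finset.mul_sum, ← Finset.sum_add_distrib]
    exact Finset.sum_congr rfl fun m _ => by ring

/-- A product of constant fields expands in the `∂_x^{n-m} ∂_y^m` with constant coefficients. That
`a` is independent of `g` and `k` lets one row vector act on both `P_d` and `G_d^2`. -/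
theorem exists_chainList_eq_sum {U : Set (ℝ × ℝ)} (hU : IsOpen U) (L : List (ℝ × ℝ)) :
    ∃ a : ℕ → ℝ, ∀ g, ContDiffOn ℝ ∞ g U → ∀ k, ∀ p ∈ U, chainList g L k p =
      ∑ m ∈ Finset.range (L.length + 1), a m * chainCoeff g (L.length - m) m k p := by
  induction L with
  | nil => exact ⟨fun _ => 1, fun g _ k p _ => by simp [chainList]⟩
  | cons v L ih =>
    obtain ⟨a, ha⟩ := ih
    -- `∂_x` keeps the exponent `m` of `∂_y`, `∂_y` raises it by one; the guards remove the
    -- out-of-range ends.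
    refine ⟨fun m => v.1 * (if m ≤ L.length then a m else 0) +
      v.2 * (if m = 0 then 0 else a (m - 1)), fun g hg k p hp => ?_⟩
    rw [chainList, chainStep_congr hU g v (fun k q hq => ha g hg k q hq) k hp,
      chainStep_const_mul_sum hU g v a (c := fun m => chainCoeff g (L.length - m) m)
        (fun m => chainCoeff_contDiffOn hU hg _ _) k hp]
    simp only [chainStep_chainCoeff hU hg v _ _ _ hp, List.length_cons, add_mul,
      Finset.sum_add_distrib, mul_add]
    congr 1
    · rw [Finset.sum_range_succ _ (L.length + 1), if_neg (by omega), mul_zero, zero_mul, add_zero]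
      refine Finset.sum_congr rfl fun m hm => ?_
      have hm : m ≤ L.length := by simpa [Nat.lt_succ_iff] using hm
      rw [if_pos hm, show L.length + 1 - m = L.length - m + 1 by omega]
      ring
    · rw [Finset.sum_range_succ' _ (L.length + 1), if_pos rfl, mul_zero, zero_mul, add_zero]
      refine Finset.sum_congr rfl fun m _ => ?_
      rw [if_neg (by omega), Nat.add_sub_cancel, Nat.add_sub_add_right]
      ring

theorem chainList_of_lt (g : ℝ × ℝ → ℝ) (L : List (ℝ × ℝ)) {k : ℕ} (h : L.length < k) :
    chainList g L k = fun _ => 0 := by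
  induction L generalizing k with
  | nil => exact chainCoeff_of_lt g (by simpa using h)
  | cons v L ih =>
    simp only [List.length_cons] at h
    obtain ⟨k, rfl⟩ : ∃ l, k = l + 1 := ⟨k - 1, by omega⟩
    ext p
    simp [chainList, chainStep, ih (show L.length < k by omega),
      ih (show L.length < k + 1 by omega), dirDeriv_const]

theorem chainList_length (g : ℝ × ℝ → ℝ) (L : List (ℝ × ℝ)) (p : ℝ × ℝ) :
    chainList g L L.length p = (L.map fun v => dirDeriv v g p).prod := by
  induction L with
  | nil => simp [chainList, chainCoeff]
  | cons v L ih =>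
    simp only [List.length_cons, chainList, chainStep, List.map_cons, List.prod_cons]
    rw [ih, chainList_of_lt g L (Nat.lt_succ_self _), dirDeriv_const, add_zero]

theorem dirDeriv_list_prod {U : Set (ℝ × ℝ)} (hU : IsOpen U) {g : ℝ × ℝ → ℝ}
    (hg : ContDiffOn ℝ ∞ g U) (L : List (ℝ × ℝ)) {p : ℝ × ℝ} (hp : p ∈ U)
    (hL : ∀ w ∈ L, dirDeriv w g p = 1) (v : ℝ × ℝ) :
    DifferentiableAt ℝ (fun q => (L.map fun w => dirDeriv w g q).prod) p ∧
    dirDeriv v (fun q => (L.map fun w => dirDeriv w g q).prod) p =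
      (L.map fun w => dirDeriv v (dirDeriv w g) p).sum := by
  induction L with
  | nil => simp [dirDeriv_const]
  | cons w L ih =>
    obtain ⟨h1, h2⟩ := ih fun x hx => hL x (List.mem_cons_of_mem _ hx)
    have hw : DifferentiableAt ℝ (dirDeriv w g) p :=
      ContDiffOn.differentiableAt_of_isOpen hU (dirDeriv_contDiffOn hU hg w) hp
    simp only [List.map_cons, List.prod_cons, List.sum_cons]
    refine ⟨hw.fun_mul h1, ?_⟩
    rw [dirDeriv_mul hw h1, h2, hL w List.mem_cons_self, one_mul, List.prod_eq_one, mul_one]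
    intro x hx
    obtain ⟨y, hy, rfl⟩ := List.mem_map.mp hx
    exact hL y (List.mem_cons_of_mem _ hy)

/-- The coefficient following the top one, when the top coefficient is a product of ones. -/
theorem two_mul_chainList {U : Set (ℝ × ℝ)} (hU : IsOpen U) {g : ℝ × ℝ → ℝ}
    (hg : ContDiffOn ℝ ∞ g U) (v : ℝ × ℝ) (L : List (ℝ × ℝ)) {p : ℝ × ℝ} (hp : p ∈ U)
    (hL : ∀ w ∈ v :: L, dirDeriv w g p = 1) :
    2 * chainList g (v :: L) L.length p =
      ((v :: L).map fun x => ((v :: L).map fun y => dirDeriv x (dirDeriv y g) p).sum).sum -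
      ((v :: L).map fun x => dirDeriv x (dirDeriv x g) p).sum := by
  induction L generalizing v with
  | nil =>
    have : chainList g [] 0 = fun _ => 1 := by ext; simp [chainList, chainCoeff]
    simp only [List.length_nil, List.map_cons, List.map_nil, List.sum_cons, List.sum_nil]
    simp only [chainList] at this ⊢
    simp only [chainStep, this, dirDeriv_const]
    ring
  | cons w L ih =>
    have hL' : ∀ x ∈ w :: L, dirDeriv x g p = 1 := fun x hx => hL x (List.mem_cons_of_mem _ hx)
    have ih := ih w hL'
    rw [chainList]
    set M := w :: L with hM
    have hlen : M.length = L.length + 1 := rfl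
    have htop : chainList g M (L.length + 1) =
        fun q => (M.map fun w => dirDeriv w g q).prod := by
      ext q
      exact chainList_length g M q
    rw [hlen]
    simp only [chainStep]
    -- Adding `v` to the list adds `∂_v` of the old top coefficient, that is, the pairs formed by
    -- `v` and a member of `M`.
    rw [hL v List.mem_cons_self, htop, (dirDeriv_list_prod hU hg M hp hL' v).2, one_mul, mul_add,
      ih]
    have hs : (M.map fun x => dirDeriv x (dirDeriv v g) p).sum =
        (M.map fun x => dirDeriv v (dirDeriv x g) p).sum := by
      congr 1
      exact List.map_congr_left fun x _ => dirDeriv_comm hU hg x v hp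
    simp only [List.map_cons, List.sum_cons, List.sum_map_add, hs]
    ring

/-- The multiple of the vector tangent to the level curve of `h` on which `dg` is `1`. -/
def levelVec (g h : ℝ × ℝ → ℝ) (p : ℝ × ℝ) : ℝ × ℝ :=
  (wedge (fderiv ℝ g) (fderiv ℝ h) p)⁻¹ • (dirDeriv dY h p, -dirDeriv dX h p)

theorem dirDeriv_levelVec_self (g h : ℝ × ℝ → ℝ) (p : ℝ × ℝ) :
    dirDeriv (levelVec g h p) h p = 0 := by
  rw [dirDeriv_eq]
  simp only [levelVec, Prod.smul_fst, Prod.smul_snd, smul_eq_mul]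
  ring

theorem dirDeriv_levelVec {g h : ℝ × ℝ → ℝ} {p : ℝ × ℝ}
    (hw : wedge (fderiv ℝ g) (fderiv ℝ h) p ≠ 0) : dirDeriv (levelVec g h p) g p = 1 := by
  rw [dirDeriv_eq]
  simp only [levelVec, Prod.smul_fst, Prod.smul_snd, smul_eq_mul]
  linear_combination inv_mul_cancel₀ hw -
    (wedge (fderiv ℝ g) (fderiv ℝ h) p)⁻¹ * wedge_eq g h p

/-- Row `i` of `P_d⁻¹` is read as a differential operator, the product of the level vectors for `j ≠
i` frozen at `p`. The factor `2` turns unordered pairs into ordered ones. -/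
theorem IsWeb.two_mul_matA_diag {d : ℕ} (hd : 3 ≤ d) {U : Set (ℝ × ℝ)} (hU : IsOpen U)
    {f : Fin d → ℝ × ℝ → ℝ} (hf : IsWeb U f) {p : ℝ × ℝ} (hp : p ∈ U) (i : Fin d) :
    2 * matA f 2 p i i = -∑ j ∈ Finset.univ.erase i, ∑ k ∈ (Finset.univ.erase i).erase j,
      dirDeriv (levelVec (f i) (f j) p) (dirDeriv (levelVec (f i) (f k) p) (f i)) p := by
  let L := (Finset.univ.erase i).toList.map fun j => levelVec (f i) (f j) p
  have hlen : L.length = d - 1 := by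
    simp [L]
  obtain ⟨a, ha⟩ := exists_chainList_eq_sum hU L
  let c : Fin d → ℝ := fun m => a m
  have hc (k : ℕ) (j : Fin d) : ∑ m, c m * chainCoeff (f j) (d - 1 - m) m k p =
      chainList (f j) L k p := by
    rw [ha (f j) (hf.smooth j) k p hp, hlen, show d - 1 + 1 = d by omega, Finset.sum_range]
  have hone : ∀ w ∈ L, dirDeriv w (f i) p = 1 := by
    intro w hw
    obtain ⟨j, hj, rfl⟩ := List.mem_map.mp hw
    have hj : j ≠ i := by simpa using hj
    exact dirDeriv_levelVec (hf.transverse p hp i j hj.symm)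
  -- The `j`-th entry is the symbol `∏ df_j(X_l)` over `l ≠ i`: for `j ≠ i` the factor `l = j` is
  -- zero, for `j = i` all factors are one.
  have hcP : Matrix.vecMul c (matP f d p) = Pi.single i 1 := by
    ext j
    have h1 : Matrix.vecMul c (matP f d p) j = chainList (f j) L (d - 1) p := hc (d - 1) j
    rw [h1, ← hlen, chainList_length]
    by_cases hij : j = i
    · subst hij
      rw [Pi.single_eq_same]
      refine List.prod_eq_one fun x hx => ?_
      obtain ⟨y, hy, rfl⟩ := List.mem_map.mp hx
      exact hone y hy
    · rw [Pi.single_eq_of_ne hij]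
      refine List.prod_eq_zero (List.mem_map.mpr ⟨levelVec (f i) (f j) p, ?_,
        dirDeriv_levelVec_self _ _ _⟩)
      exact List.mem_map.mpr ⟨j, by simpa using hij, rfl⟩
  have hA : matA f 2 p i i = -chainList (f i) L (d - 2) p := by
    have hdet := isUnit_iff_ne_zero.mpr (hf.det_matP_ne_zero hp)
    have h1 : ((matP f d p)⁻¹ * matG f d 2 p) i i =
        Matrix.vecMul (Pi.single i 1) ((matP f d p)⁻¹ * matG f d 2 p) i := by
      rw [Matrix.single_one_vecMul]
      rfl
    rw [matA, Matrix.neg_apply, h1, ← hcP, Matrix.vecMul_vecMul, ← Matrix.mul_assoc,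
      Matrix.mul_nonsing_inv _ hdet, Matrix.one_mul, ← hc]
    rfl
  obtain ⟨v, M, hM⟩ : ∃ v M, L = v :: M := List.exists_cons_of_length_pos (by omega)
  have hMlen : M.length = d - 2 := by
    rw [hM, List.length_cons] at hlen
    omega
  have h2 := two_mul_chainList hU (hf.smooth i) v M hp (by rwa [← hM])
  rw [← hM, hMlen] at h2
  rw [hA, mul_neg, h2]
  simp only [L, List.map_map, Function.comp_def, Finset.sum_map_toList]
  rw [← Finset.sum_sub_distrib]
  congr 1
  refine Finset.sum_congr rfl fun j hj => ?_
  rw [← Finset.sum_erase_add _ _ hj, add_sub_cancel_right]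

/-! ### The Blaschke form -/

theorem extD_apply {α : ℝ × ℝ → (ℝ × ℝ →L[ℝ] ℝ)} {p : ℝ × ℝ} (hα : DifferentiableAt ℝ α p)
    (u v : ℝ × ℝ) : extD α p ![u, v] =
      dirDeriv u (fun q => α q v) p - dirDeriv v (fun q => α q u) p := by
  have hd : DifferentiableAt ℝ
      (fun q => ContinuousAlternatingMap.ofSubsingleton ℝ (ℝ × ℝ) ℝ (0 : Fin 1) (α q)) p :=
    (ContinuousAlternatingMap.ofSubsingletonLIE (𝕜 := ℝ) (E := ℝ × ℝ) (F := ℝ)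
      (0 : Fin 1)).differentiableAt.comp p hα
  rw [extD, extDeriv_apply hd]
  simp [Fin.sum_univ_two, dirDeriv, Fin.removeNth]
  ring

theorem dirDeriv_dirDeriv_eq {U : Set (ℝ × ℝ)} (hU : IsOpen U) {g : ℝ × ℝ → ℝ}
    (hg : ContDiffOn ℝ ∞ g U) (u v : ℝ × ℝ) {p : ℝ × ℝ} (hp : p ∈ U) :
    dirDeriv u (dirDeriv v g) p = u.1 * v.1 * dirDeriv dX (dirDeriv dX g) p +
      (u.1 * v.2 + u.2 * v.1) * dirDeriv dX (dirDeriv dY g) p +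
      u.2 * v.2 * dirDeriv dY (dirDeriv dY g) p := by
  have hd (w) : DifferentiableAt ℝ (dirDeriv w g) p :=
    ContDiffOn.differentiableAt_of_isOpen hU (dirDeriv_contDiffOn hU hg w) hp
  have key (u : ℝ × ℝ) : dirDeriv u (dirDeriv v g) p =
      v.1 * dirDeriv u (dirDeriv dX g) p + v.2 * dirDeriv u (dirDeriv dY g) p := by
    rw [show dirDeriv v g = fun q => v.1 * dirDeriv dX g q + v.2 * dirDeriv dY g q from
      funext fun q => dirDeriv_eq v g q, dirDeriv_add ((hd _).const_mul _) ((hd _).const_mul _),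
      dirDeriv_mul (differentiableAt_const _) (hd _),
      dirDeriv_mul (differentiableAt_const _) (hd _),
      dirDeriv_const, dirDeriv_const]
    ring
  rw [dirDeriv_eq u, key dX, key dY, dirDeriv_comm hU hg dY dX hp]
  ring

section ThreeWeb

variable {U : Set (ℝ × ℝ)} {f g h : ℝ × ℝ → ℝ}

theorem contDiffOn_wedge (hU : IsOpen U) (hg : ContDiffOn ℝ ∞ g U) (hh : ContDiffOn ℝ ∞ h U) :
    ContDiffOn ℝ ∞ (wedge (fderiv ℝ g) (fderiv ℝ h)) U :=
  ((dirDeriv_contDiffOn hU hg dX).mul (dirDeriv_contDiffOn hU hh dY)).sub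
    ((dirDeriv_contDiffOn hU hg dY).mul (dirDeriv_contDiffOn hU hh dX))

theorem contDiffOn_normForm (hU : IsOpen U) (hf : ContDiffOn ℝ ∞ f U) (hg : ContDiffOn ℝ ∞ g U)
    (hh : ContDiffOn ℝ ∞ h U) : ContDiffOn ℝ ∞ (normForm f g h) U :=
  (contDiffOn_wedge hU hg hh).smul (hf.fderiv_of_isOpen hU (m := ∞) (by simp))

theorem extD_contDiffOn (hU : IsOpen U) {α : ℝ × ℝ → (ℝ × ℝ →L[ℝ] ℝ)} (hα : ContDiffOn ℝ ∞ α U)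
    (u v : ℝ × ℝ) : ContDiffOn ℝ ∞ (fun q => extD α q ![u, v]) U :=
  ((dirDeriv_contDiffOn hU (hα.clm_apply contDiffOn_const) u).sub
    (dirDeriv_contDiffOn hU (hα.clm_apply contDiffOn_const) v)).congr fun _ hp =>
      extD_apply (ContDiffOn.differentiableAt_of_isOpen hU hα hp) u v

theorem wedge_normForm (f g h : ℝ × ℝ → ℝ) (p : ℝ × ℝ) :
    wedge (normForm f g h) (normForm g h f) p = wedge (fderiv ℝ g) (fderiv ℝ h) p *
      wedge (fderiv ℝ h) (fderiv ℝ f) p * wedge (fderiv ℝ f) (fderiv ℝ g) p := by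
  simp only [wedge, normForm, smul_apply, smul_eq_mul]
  ring

theorem contDiffOn_blaschkeForm (hU : IsOpen U) (hf : ContDiffOn ℝ ∞ f U)
    (hg : ContDiffOn ℝ ∞ g U) (hh : ContDiffOn ℝ ∞ h U)
    (hfg : ∀ p ∈ U, wedge (fderiv ℝ f) (fderiv ℝ g) p ≠ 0)
    (hgh : ∀ p ∈ U, wedge (fderiv ℝ g) (fderiv ℝ h) p ≠ 0)
    (hhf : ∀ p ∈ U, wedge (fderiv ℝ h) (fderiv ℝ f) p ≠ 0) :
    ContDiffOn ℝ ∞ (blaschkeForm f g h) U := by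
  have h1 := contDiffOn_normForm hU hf hg hh
  have h2 := contDiffOn_normForm hU hg hh hf
  have hw : ContDiffOn ℝ ∞ (wedge (normForm f g h) (normForm g h f)) U :=
    (((contDiffOn_wedge hU hg hh).mul (contDiffOn_wedge hU hh hf)).mul
      (contDiffOn_wedge hU hf hg)).congr fun p _ => wedge_normForm f g h p
  have hw0 : ∀ p ∈ U, wedge (normForm f g h) (normForm g h f) p ≠ 0 := fun p hp => by
    rw [wedge_normForm]
    exact mul_ne_zero (mul_ne_zero (hgh p hp) (hhf p hp)) (hfg p hp)
  exact (((extD_contDiffOn hU h2 dX dY).div hw hw0).smul h1).sub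
    (((extD_contDiffOn hU h1 dX dY).div hw hw0).smul h2)

theorem extD_normForm (hU : IsOpen U) (hf : ContDiffOn ℝ ∞ f U) (hg : ContDiffOn ℝ ∞ g U)
    (hh : ContDiffOn ℝ ∞ h U) {p : ℝ × ℝ} (hp : p ∈ U) : extD (normForm f g h) p ![dX, dY] =
    (dirDeriv dX (dirDeriv dX g) p * dirDeriv dY h p +
      dirDeriv dX g p * dirDeriv dX (dirDeriv dY h) p -
      dirDeriv dX (dirDeriv dY g) p * dirDeriv dX h p -
      dirDeriv dY g p * dirDeriv dX (dirDeriv dX h) p) * dirDeriv dY f p -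
    (dirDeriv dX (dirDeriv dY g) p * dirDeriv dY h p +
      dirDeriv dX g p * dirDeriv dY (dirDeriv dY h) p -
      dirDeriv dY (dirDeriv dY g) p * dirDeriv dX h p -
      dirDeriv dY g p * dirDeriv dX (dirDeriv dY h) p) * dirDeriv dX f p := by
  have hd {k : ℝ × ℝ → ℝ} (hk : ContDiffOn ℝ ∞ k U) (w) : DifferentiableAt ℝ (dirDeriv w k) p :=
    ContDiffOn.differentiableAt_of_isOpen hU (dirDeriv_contDiffOn hU hk w) hp
  have hwd : DifferentiableAt ℝ (wedge (fderiv ℝ g) (fderiv ℝ h)) p :=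
    ContDiffOn.differentiableAt_of_isOpen hU (contDiffOn_wedge hU hg hh) hp
  have hw (u : ℝ × ℝ) : dirDeriv u (wedge (fderiv ℝ g) (fderiv ℝ h)) p =
      dirDeriv u (dirDeriv dX g) p * dirDeriv dY h p +
      dirDeriv dX g p * dirDeriv u (dirDeriv dY h) p -
      (dirDeriv u (dirDeriv dY g) p * dirDeriv dX h p +
      dirDeriv dY g p * dirDeriv u (dirDeriv dX h) p) := by
    rw [show wedge (fderiv ℝ g) (fderiv ℝ h) = fun q => dirDeriv dX g q * dirDeriv dY h q -
      dirDeriv dY g q * dirDeriv dX h q from rfl,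
      dirDeriv_sub ((hd hg _).fun_mul (hd hh _)) ((hd hg _).fun_mul (hd hh _)),
      dirDeriv_mul (hd hg _) (hd hh _), dirDeriv_mul (hd hg _) (hd hh _)]
  rw [extD_apply (ContDiffOn.differentiableAt_of_isOpen hU (contDiffOn_normForm hU hf hg hh) hp)]
  have hn (v : ℝ × ℝ) : (fun q => normForm f g h q v) =
      fun q => wedge (fderiv ℝ g) (fderiv ℝ h) q * dirDeriv v f q := rfl
  rw [hn, hn, dirDeriv_mul hwd (hd hf _), dirDeriv_mul hwd (hd hf _), hw, hw,
    dirDeriv_comm hU hf dY dX hp, dirDeriv_comm hU hg dY dX hp, dirDeriv_comm hU hh dY dX hp]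
  ring

/-- The contribution of the second derivatives of `f` to the Blaschke form of `W(f, g, h)`. -/
def hessTerm (f g h : ℝ × ℝ → ℝ) (v p : ℝ × ℝ) : ℝ :=
  dirDeriv v f p * dirDeriv (levelVec f g p) (dirDeriv (levelVec f h p) f) p

theorem hessTerm_eq (hU : IsOpen U) (hf : ContDiffOn ℝ ∞ f U) (g h : ℝ × ℝ → ℝ) (v : ℝ × ℝ)
    {p : ℝ × ℝ} (hp : p ∈ U) : hessTerm f g h v p = dirDeriv v f p *
      ((wedge (fderiv ℝ f) (fderiv ℝ g) p)⁻¹ * (wedge (fderiv ℝ f) (fderiv ℝ h) p)⁻¹ *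
        (dirDeriv dX (dirDeriv dX f) p * dirDeriv dY g p * dirDeriv dY h p -
          dirDeriv dX (dirDeriv dY f) p *
            (dirDeriv dY g p * dirDeriv dX h p + dirDeriv dX g p * dirDeriv dY h p) +
          dirDeriv dY (dirDeriv dY f) p * dirDeriv dX g p * dirDeriv dX h p)) := by
  rw [hessTerm, dirDeriv_dirDeriv_eq hU hf (levelVec f g p) (levelVec f h p) hp]
  simp only [levelVec, Prod.smul_fst, Prod.smul_snd, smul_eq_mul]
  ring

theorem hessTerm_swap (hU : IsOpen U) (hf : ContDiffOn ℝ ∞ f U) (v : ℝ × ℝ) {p : ℝ × ℝ}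
    (hp : p ∈ U) : hessTerm f g h v p = hessTerm f h g v p := by
  rw [hessTerm, hessTerm, dirDeriv_comm hU hf _ _ hp]

theorem wedge_swap (α β : ℝ × ℝ → (ℝ × ℝ →L[ℝ] ℝ)) (p : ℝ × ℝ) :
    wedge α β p = -wedge β α p := by
  simp only [wedge]
  ring

/-- Both sides are linear in the second derivatives of `f`, `g`, `h`, with the pairwise wedges as
denominators; once these are cleared, a polynomial identity remains. This form exposes the symmetry
needed to sum over triples. -/
theorem blaschkeForm_apply (hU : IsOpen U) (hf : ContDiffOn ℝ ∞ f U)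
    (hg : ContDiffOn ℝ ∞ g U) (hh : ContDiffOn ℝ ∞ h U) {p : ℝ × ℝ} (hp : p ∈ U)
    (hfg : wedge (fderiv ℝ f) (fderiv ℝ g) p ≠ 0)
    (hgh : wedge (fderiv ℝ g) (fderiv ℝ h) p ≠ 0)
    (hhf : wedge (fderiv ℝ h) (fderiv ℝ f) p ≠ 0) (v : ℝ × ℝ) :
    blaschkeForm f g h p v =
      hessTerm f g h v p + hessTerm g h f v p + hessTerm h f g v p := by
  simp only [blaschkeForm, sub_apply, smul_apply,
    smul_eq_mul]
  rw [extD_normForm hU hf hg hh hp, extD_normForm hU hg hh hf hp, wedge_normForm]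
  simp only [normForm, smul_apply, smul_eq_mul]
  rw [hessTerm_eq hU hf g h v hp, hessTerm_eq hU hg h f v hp, hessTerm_eq hU hh f g v hp]
  rw [wedge_swap (fderiv ℝ f) (fderiv ℝ h), wedge_swap (fderiv ℝ g) (fderiv ℝ f),
    wedge_swap (fderiv ℝ h) (fderiv ℝ g)]
  have hfv (k : ℝ × ℝ → ℝ) : fderiv ℝ k p v = v.1 * dirDeriv dX k p + v.2 * dirDeriv dY k p :=
    dirDeriv_eq v k p
  rw [hfv, hfv, dirDeriv_eq v f, dirDeriv_eq v g, dirDeriv_eq v h]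
  -- The wedges stay atoms while denominators are cleared and are expanded only afterwards.
  have eA := wedge_eq g h p
  have eB := wedge_eq h f p
  have eC := wedge_eq f g p
  set A := wedge (fderiv ℝ g) (fderiv ℝ h) p
  set B := wedge (fderiv ℝ h) (fderiv ℝ f) p
  set C := wedge (fderiv ℝ f) (fderiv ℝ g) p
  field_simp
  rw [eA, eB, eC]
  ring

end ThreeWeb

/-! ### The trace formula -/

/-- A sum over triples of distinct indices, as a sum over increasing triples. -/
theorem sum_distinct_triples {d : ℕ} (F : Fin d → Fin d → Fin d → ℝ)
    (hF : ∀ i j k, F i j k = F i k j) :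
    ∑ i, ∑ j ∈ Finset.univ.erase i, ∑ k ∈ (Finset.univ.erase i).erase j, F i j k =
      2 * ∑ t : Fin d × Fin d × Fin d with t.1 < t.2.1 ∧ t.2.1 < t.2.2,
        (F t.1 t.2.1 t.2.2 + F t.2.1 t.2.2 t.1 + F t.2.2 t.1 t.2.1) := by
  -- Split by the six orderings of `i, j, k`; after renaming, the symmetry in the last two arguments
  -- pairs them and gives the factor `2`.
  have h1 : ∑ i, ∑ j ∈ Finset.univ.erase i, ∑ k ∈ (Finset.univ.erase i).erase j, F i j k =
      ∑ i, ∑ j, ∑ k, ((if i < j ∧ j < k then F i j k else 0) +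
        (if i < k ∧ k < j then F i j k else 0) + (if j < i ∧ i < k then F i j k else 0) +
        (if j < k ∧ k < i then F i j k else 0) + (if k < i ∧ i < j then F i j k else 0) +
        (if k < j ∧ j < i then F i j k else 0)) := by
    refine Finset.sum_congr rfl fun i _ => ?_
    rw [← Finset.filter_ne', Finset.sum_filter]
    refine Finset.sum_congr rfl fun j _ => ?_
    rw [← Finset.filter_ne', Finset.filter_filter, Finset.sum_filter]
    split_ifs with hji
    · refine Finset.sum_congr rfl fun k _ => ?_
      split_ifs <;> first | omega | simp
    · have : j = i := by simpa using hji
      subst this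
      refine (Finset.sum_eq_zero fun k _ => ?_).symm
      split_ifs <;> first | omega | simp
  have h2 (G : Fin d → Fin d → Fin d → ℝ) :
      ∑ t : Fin d × Fin d × Fin d with t.1 < t.2.1 ∧ t.2.1 < t.2.2, G t.1 t.2.1 t.2.2 =
        ∑ i, ∑ j, ∑ k, if i < j ∧ j < k then G i j k else 0 := by
    rw [Finset.sum_filter, Fintype.sum_prod_type]
    exact Finset.sum_congr rfl fun i _ => Fintype.sum_prod_type _
  have e2 : ∑ i, ∑ j, ∑ k, (if i < k ∧ k < j then F i j k else 0) =
      ∑ i, ∑ j, ∑ k, if i < j ∧ j < k then F i k j else 0 :=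
    Finset.sum_congr rfl fun i _ => Finset.sum_comm
  have e3 : ∑ i, ∑ j, ∑ k, (if j < i ∧ i < k then F i j k else 0) =
      ∑ i, ∑ j, ∑ k, if i < j ∧ j < k then F j i k else 0 := Finset.sum_comm
  have e4 : ∑ i, ∑ j, ∑ k, (if j < k ∧ k < i then F i j k else 0) =
      ∑ i, ∑ j, ∑ k, if i < j ∧ j < k then F k i j else 0 :=
    Finset.sum_comm.trans (Finset.sum_congr rfl fun i _ => Finset.sum_comm)
  have e5 : ∑ i, ∑ j, ∑ k, (if k < i ∧ i < j then F i j k else 0) =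
      ∑ i, ∑ j, ∑ k, if i < j ∧ j < k then F j k i else 0 :=
    (Finset.sum_congr rfl fun i _ => Finset.sum_comm).trans Finset.sum_comm
  have e6 : ∑ i, ∑ j, ∑ k, (if k < j ∧ j < i then F i j k else 0) =
      ∑ i, ∑ j, ∑ k, if i < j ∧ j < k then F k j i else 0 :=
    (Finset.sum_comm.trans (Finset.sum_congr rfl fun i _ => Finset.sum_comm)).trans
      Finset.sum_comm
  simp only [Finset.sum_add_distrib] at h1
  rw [h1, e2, e3, e4, e5, e6]
  simp only [← h2, ← Finset.sum_add_distrib, Finset.mul_sum]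
  refine Finset.sum_congr rfl fun t _ => ?_
  rw [hF t.1 t.2.2, hF t.2.1 t.1, hF t.2.2 t.2.1]
  ring

theorem IsWeb.trace_matDeltaDir_eq {d : ℕ} (hd : 3 ≤ d) {U : Set (ℝ × ℝ)} (hU : IsOpen U)
    {f : Fin d → ℝ × ℝ → ℝ} (hf : IsWeb U f) (v : ℝ × ℝ) {p : ℝ × ℝ} (hp : p ∈ U) :
    (matDeltaDir f v p).trace =
      -∑ t : Fin d × Fin d × Fin d with t.1 < t.2.1 ∧ t.2.1 < t.2.2,
        blaschkeForm (f t.1) (f t.2.1) (f t.2.2) p v := by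
  have h1 : 2 * (matDeltaDir f v p).trace = -∑ i, ∑ j ∈ Finset.univ.erase i,
      ∑ k ∈ (Finset.univ.erase i).erase j, hessTerm (f i) (f j) (f k) v p := by
    rw [trace_matDeltaDir hd, Finset.mul_sum, ← Finset.sum_neg_distrib]
    refine Finset.sum_congr rfl fun i _ => ?_
    rw [mul_left_comm, hf.two_mul_matA_diag hd hU hp, mul_neg]
    simp only [Finset.mul_sum, hessTerm]
  rw [sum_distinct_triples (fun i j k => hessTerm (f i) (f j) (f k) v p)
    fun i j k => hessTerm_swap hU (hf.smooth i) v hp] at h1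
  have h2 : ∑ t : Fin d × Fin d × Fin d with t.1 < t.2.1 ∧ t.2.1 < t.2.2,
      blaschkeForm (f t.1) (f t.2.1) (f t.2.2) p v =
      ∑ t : Fin d × Fin d × Fin d with t.1 < t.2.1 ∧ t.2.1 < t.2.2,
        (hessTerm (f t.1) (f t.2.1) (f t.2.2) v p + hessTerm (f t.2.1) (f t.2.2) (f t.1) v p +
          hessTerm (f t.2.2) (f t.1) (f t.2.1) v p) := by
    refine Finset.sum_congr rfl fun t ht => ?_
    obtain ⟨h12, h23⟩ := (Finset.mem_filter.mp ht).2
    exact blaschkeForm_apply hU (hf.smooth _) (hf.smooth _) (hf.smooth _) hp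
      (hf.transverse p hp _ _ h12.ne) (hf.transverse p hp _ _ h23.ne)
      (hf.transverse p hp _ _ (h12.trans h23).ne') v
  rw [h2]
  linarith

theorem IsWeb.trace_curvatureMatrix_eq {d : ℕ} (hd : 3 ≤ d) {U : Set (ℝ × ℝ)} (hU : IsOpen U)
    {f : Fin d → ℝ × ℝ → ℝ} (hf : IsWeb U f) {p : ℝ × ℝ} (hp : p ∈ U) (u v : ℝ × ℝ) :
    (curvatureMatrix f u v p).trace =
      ∑ t : Fin d × Fin d × Fin d with t.1 < t.2.1 ∧ t.2.1 < t.2.2,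
        blaschkeCurvature (f t.1) (f t.2.1) (f t.2.2) p ![u, v] := by
  have hsm (t : Fin d × Fin d × Fin d)
      (ht : t ∈ Finset.univ.filter fun t : Fin d × Fin d × Fin d => t.1 < t.2.1 ∧ t.2.1 < t.2.2) :
      DifferentiableAt ℝ (blaschkeForm (f t.1) (f t.2.1) (f t.2.2)) p := by
    obtain ⟨h12, h23⟩ := (Finset.mem_filter.mp ht).2
    exact ContDiffOn.differentiableAt_of_isOpen hU
      (contDiffOn_blaschkeForm hU (hf.smooth _) (hf.smooth _) (hf.smooth _)
        (fun q hq => hf.transverse q hq _ _ h12.ne) (fun q hq => hf.transverse q hq _ _ h23.ne)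
        (fun q hq => hf.transverse q hq _ _ (h12.trans h23).ne')) hp
  have key (u v : ℝ × ℝ) : dirDeriv u (fun q => (matDeltaDir f v q).trace) p =
      -∑ t : Fin d × Fin d × Fin d with t.1 < t.2.1 ∧ t.2.1 < t.2.2,
        dirDeriv u (fun q => blaschkeForm (f t.1) (f t.2.1) (f t.2.2) q v) p := by
    rw [dirDeriv_congr hU (fun q hq => hf.trace_matDeltaDir_eq hd hU v hq) u hp]
    rw [← dirDeriv_sum fun t ht => (hsm t ht).clm_apply (differentiableAt_const v)]
    simp [dirDeriv, fderiv_fun_neg]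
  rw [hf.trace_curvatureMatrix hU u v hp, key, key, neg_sub_neg, ← Finset.sum_sub_distrib]
  exact Finset.sum_congr rfl fun t ht => (extD_apply (hsm t ht) u v).symm

end PlanarWeb

end

theorem mainTheorem1 (d : ℕ) (hd : 3 ≤ d) (U : Set (ℝ × ℝ)) (hU : IsOpen U)
    (f : Fin d → ℝ × ℝ → ℝ) (hf : PlanarWeb.IsWeb U f) :
    -- the kernel of `MM` has constant rank `(d-1)(d-2)/2`
    (∀ p ∈ U, Module.finrank ℝ (PlanarWeb.fiber f p) = (d - 1) * (d - 2) / 2) ∧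
    -- the connection preserves the sections of the kernel of `MM`
    (∀ V ⊆ U, IsOpen V → ∀ s, PlanarWeb.IsSection f V s →
      ∀ v, PlanarWeb.IsSection f V (PlanarWeb.nabla f v s)) ∧
    -- the curvature is well defined, and its trace is the sum of the Blaschke curvatures
    (∀ p ∈ U, ∀ u v : ℝ × ℝ, ∃ K : Module.End ℝ (PlanarWeb.fiber f p),
      PlanarWeb.IsCurvatureAt f p u v K ∧
      (∀ K', PlanarWeb.IsCurvatureAt f p u v K' → K' = K) ∧
      LinearMap.trace ℝ (PlanarWeb.fiber f p) K =
        ∑ t : Fin d × Fin d × Fin d with t.1 < t.2.1 ∧ t.2.1 < t.2.2,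
          PlanarWeb.blaschkeCurvature (f t.1) (f t.2.1) (f t.2.2) p ![u, v]) := by
  refine ⟨fun p hp => hf.finrank_fiber hd hp,
    fun V hV hVo s hs v => hf.isSection_nabla hd hU hV hVo hs v, fun p hp u v => ?_⟩
  obtain ⟨K, hK, huniq, htr⟩ := hf.exists_isCurvatureAt hd hU hp u v
  exact ⟨K, hK, huniq, htr.trans (hf.trace_curvatureMatrix_eq hd hU hp u v)⟩
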